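/- A Schmidt group is a finite non-nilpotent group all of whose proper subgroups are nilpotent. Let $p \ne q$ be primes and let $v \ge 1$ be an integer. A Schmidt group $G$ is said to have parameters $p, q, v$ if its derived subgroup $G'$ is a $p$-group and $G$ is the internal semidirect product $G = G' \rtimes C$ of $G'$ and a cyclic subgroup $C$ of order $q^v$. For a group $G$, let $\mathrm{End}(G)$ denote the semigroup of all endomorphisms of $G$ under composition. Theorem. Let $G$ be a Schmidt group with parameters $p, q, v$, and let $H$ be an arbitrary group (not assumed finite) such that the semigroups $\mathrm{End}(G)$ and $\mathrm{End}(H)$ are isomorphic. Then $H$ is a Schmidt group with parameters $p, q, v$. -/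

import Mathlib

/-- A Schmidt group: a finite non-nilpotent group all of whose proper subgroups are nilpotent. -/
structure IsSchmidtGroup (G : Type*) [Group G] : Prop where
  finite : Finite G
  not_nilpotent : ¬ Group.IsNilpotent G
  nilpotent_of_ne_top : ∀ K : Subgroup G, K ≠ ⊤ → Group.IsNilpotent K

/-- A Schmidt group with parameters `p`, `q`, `v`: the numbers `p` and `q` are distinct primes,
`1 ≤ v`, the derived subgroup is a `p`-group, and the whole group is the (internal) semidirect
product of its derived subgroup and a cyclic subgroup of order `q ^ v`. -/
structure IsSchmidtGroupWith (p q v : ℕ) (G : Type*) [Group G] : Prop where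
  isSchmidtGroup : IsSchmidtGroup G
  prime_p : p.Prime
  prime_q : q.Prime
  p_ne_q : p ≠ q
  one_le_v : 1 ≤ v
  isPGroup_commutator : IsPGroup p (commutator G)
  exists_complement : ∃ C : Subgroup G,
    IsCyclic C ∧ Nat.card C = q ^ v ∧ (commutator G).IsComplement' C

open scoped commutatorElement

/-! Write `G = P ⋊ ⟨c⟩` with `P = G'`, and let `ε` be the projection onto `⟨c⟩` with kernel `P`. The
proof lists properties of `ε` that mention only the monoid `End G` (`EndProfile`), carries them to
`End H` along the isomorphism, and rebuilds the Schmidt structure of `H` from them.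

The dictionary is as follows. The group `fixer ε` consists of the automorphisms preserving `ε`; it
contains all inner ones because `⟨c⟩` is abelian. The clause `absorb` says that non-automorphisms
kill `P`: their image is a proper, hence nilpotent, subgroup. The clause `corner` identifies the
endomorphisms of `⟨c⟩` with multiplication on `ZMod (q ^ v)`, and its last part encodes the
centrality of `c ^ q`. The clause `conj` is Sylow conjugacy for `q`-elements. In `translations`, `V`
is the group of inner automorphisms by `P`, on which every element of order `q` in `fixer ε` acts
irreducibly, by Schur's lemma.

In `H`, the corner forces the image of the idempotent to be cyclic of order `q ^ v`
(`isCyclic_of_end_mulEquiv_zmod`). Every non-automorphism kills the kernel, so constructing suitable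
non-automorphisms shows that the kernel has finite exponent and equals `H'` (`mem_commutator_iff`).
Schur's theorem on groups with centre of finite index then makes `H` finite. Finally `V` controls
the inner automorphisms by `H'`: it gives that `H'` is a `p`-group, that `H` is not nilpotent, and
that proper subgroups are nilpotent. -/

/-! ### Endomorphism monoids and inner automorphisms. -/

/-- A group homomorphism from a group to itself, as an element of its endomorphism monoid. -/
def toEnd {X : Type*} [Group X] (f : X →* X) : Monoid.End X := f

@[simp]
theorem toEnd_apply {X : Type*} [Group X] (f : X →* X) (x : X) : toEnd f x = f x := rfl

/-- The inner automorphisms of a group, as units of its endomorphism monoid. -/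
def innerUnit (X : Type*) [Group X] : X →* (Monoid.End X)ˣ :=
  MonoidHom.toHomUnits
    { toFun := fun x => toEnd (MulAut.conj x).toMonoidHom
      map_one' := by
        ext g
        change 1 * g * 1⁻¹ = g
        simp
      map_mul' := fun x y => by
        ext g
        change x * y * g * (x * y)⁻¹ = x * (y * g * y⁻¹) * x⁻¹
        group }

@[simp]
theorem innerUnit_apply {X : Type*} [Group X] (x g : X) :
    (innerUnit X x : Monoid.End X) g = x * g * x⁻¹ := rfl

theorem monoidEnd_mul_apply {X : Type*} [Group X] (f g : Monoid.End X) (x : X) :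
    (f * g) x = f (g x) := rfl

theorem monoidEnd_one_apply {X : Type*} [Group X] (x : X) : (1 : Monoid.End X) x = x := rfl

@[simp]
theorem unit_inv_apply_self {X : Type*} [Group X] (α : (Monoid.End X)ˣ) (x : X) :
    (↑α⁻¹ : Monoid.End X) ((α : Monoid.End X) x) = x := by
  rw [← monoidEnd_mul_apply, Units.inv_mul, monoidEnd_one_apply]

@[simp]
theorem unit_apply_inv_self {X : Type*} [Group X] (α : (Monoid.End X)ˣ) (x : X) :
    (α : Monoid.End X) ((↑α⁻¹ : Monoid.End X) x) = x := by
  rw [← monoidEnd_mul_apply, Units.mul_inv, monoidEnd_one_apply]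

theorem isUnit_monoidEnd_of_bijective {X : Type*} [Group X] (f : Monoid.End X)
    (hf : Function.Bijective f) : IsUnit f := by
  let F : X ≃* X := MulEquiv.ofBijective f hf
  refine ⟨⟨f, F.symm.toMonoidHom, ?_, ?_⟩, rfl⟩
  · ext x; exact F.apply_symm_apply x
  · ext x; exact F.symm_apply_apply x

theorem injective_of_isUnit_monoidEnd {X : Type*} [Group X] {f : Monoid.End X} (hf : IsUnit f) :
    Function.Injective f := by
  obtain ⟨α, rfl⟩ := hf
  exact Function.LeftInverse.injective (unit_inv_apply_self α)

theorem surjective_of_isUnit_monoidEnd {X : Type*} [Group X] {f : Monoid.End X} (hf : IsUnit f) :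
    Function.Surjective f := by
  obtain ⟨α, rfl⟩ := hf
  exact Function.RightInverse.surjective (unit_apply_inv_self α)

theorem innerUnit_eq_one_iff {X : Type*} [Group X] (x : X) :
    innerUnit X x = 1 ↔ x ∈ Subgroup.center X := by
  rw [Subgroup.mem_center_iff, Units.ext_iff]
  constructor
  · intro h g
    have := DFunLike.congr_fun h g
    rw [innerUnit_apply, Units.val_one, monoidEnd_one_apply, mul_inv_eq_iff_eq_mul] at this
    exact this.symm
  · intro h
    ext g
    rw [innerUnit_apply, ← h g, mul_inv_cancel_right]; rfl

theorem unit_conj_innerUnit {X : Type*} [Group X] (α : (Monoid.End X)ˣ) (x : X) :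
    α * innerUnit X x * α⁻¹ = innerUnit X ((α : Monoid.End X) x) := by
  ext g
  simp only [Units.val_mul, monoidEnd_mul_apply, innerUnit_apply, map_mul, map_inv,
    unit_apply_inv_self]

/-! ### The monoid-theoretic profile and its invariance under isomorphism. -/

/-- The units of a monoid that fix a given element under right multiplication. -/
def fixer {E : Type*} [Monoid E] (ε : E) : Subgroup Eˣ where
  carrier := {u | ε * u = ε}
  one_mem' := by simp
  mul_mem' := by
    intro a b ha hb
    simp only [Set.mem_ofPred_eq, Units.val_mul] at *
    rw [← mul_assoc, ha, hb]
  inv_mem' := by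
    intro a ha
    simp only [Set.mem_ofPred_eq] at *
    rw [Units.mul_inv_eq_iff_eq_mul, ha]

theorem mem_fixer {E : Type*} [Monoid E] {ε : E} {u : Eˣ} : u ∈ fixer ε ↔ ε * u = ε := Iff.rfl

/-- The monoid-theoretic features of an idempotent `ε` that are shared by the projections of a
Schmidt group with parameters `p, q, v` onto a complement of its derived subgroup. -/
structure EndProfile (p q v : ℕ) {E : Type*} [Monoid E] (ε : E) : Prop where
  finite : Finite E
  idem : ε * ε = ε
  not_isUnit : ¬ IsUnit ε
  absorb : ∀ f : E, ¬ IsUnit f → f * ε = f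
  corner : ∃ φ : ZMod (q ^ v) → E, Function.Injective φ ∧ (∀ a b, φ (a * b) = φ a * φ b) ∧
    φ 1 = ε ∧ (∀ f, ε * f = f → f * ε = f → ∃ a, φ a = f) ∧
    ∀ a, ¬ IsUnit a → ∀ α ∈ fixer ε, (α : E) * φ a = φ a
  conj : ∀ f : E, ¬ IsUnit f → ∃ α ∈ fixer ε, ε * (↑α⁻¹ * f) = ↑α⁻¹ * f
  translations : ∃ V : Subgroup Eˣ, IsPGroup p V ∧
    (∀ α ∈ fixer ε, ∀ β ∈ fixer ε, ⁅α, β⁆ ∈ V) ∧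
    ∀ t ∈ fixer ε, t ^ q = 1 → t ≠ 1 → ∀ W ≤ V, (∀ w ∈ W, t * w * t⁻¹ ∈ W) → W = ⊥ ∨ W = V

theorem map_mem_fixer {E E' : Type*} [Monoid E] [Monoid E'] (e : E ≃* E') {ε : E} {u : E'ˣ} :
    u ∈ fixer (e ε) ↔ (Units.mapEquiv e).symm u ∈ fixer ε := by
  rw [mem_fixer, mem_fixer, ← e.injective.eq_iff]
  simp

theorem EndProfile.map {p q v : ℕ} {E E' : Type*} [Monoid E] [Monoid E'] (e : E ≃* E') {ε : E}
    (h : EndProfile p q v ε) : EndProfile p q v (e ε) := by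
  have key : ∀ f : E', ¬ IsUnit f → ¬ IsUnit (e.symm f) := fun f hf hu => hf (by
    simpa using hu.map e)
  constructor
  · have := h.finite
    exact Finite.of_equiv E e.toEquiv
  · rw [← map_mul, h.idem]
  · exact fun hu => h.not_isUnit (by simpa using hu.map e.symm)
  · intro f hf
    have := congrArg e (h.absorb _ (key f hf))
    simpa using this
  · obtain ⟨φ, hφ, hmul, h1, hs, hfix⟩ := h.corner
    refine ⟨fun a => e (φ a), e.injective.comp hφ, fun a b => by simp only [hmul, map_mul], congrArg e h1,
      fun f hl hr => ?_, fun a ha α hα => ?_⟩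
    · obtain ⟨a, ha⟩ := hs (e.symm f) (by simpa using congrArg e.symm hl)
        (by simpa using congrArg e.symm hr)
      exact ⟨a, by simp only [ha, e.apply_symm_apply]⟩
    · have := congrArg e (hfix a ha _ ((map_mem_fixer e).1 hα))
      simpa using this
  · intro f hf
    obtain ⟨α, hα, h'⟩ := h.conj _ (key f hf)
    refine ⟨Units.mapEquiv e α, (map_mem_fixer e).2 (by rwa [MulEquiv.symm_apply_apply]), ?_⟩
    have := congrArg e h'
    rw [← map_inv, Units.coe_mapEquiv]
    simpa using this
  · obtain ⟨V, hV, hc, hi⟩ := h.translations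
    refine ⟨V.map (Units.mapEquiv e).toMonoidHom, hV.map _, fun α hα β hβ => ?_,
      fun t ht htq ht1 W hWV hW => ?_⟩
    · have := Subgroup.mem_map_of_mem (Units.mapEquiv e).toMonoidHom
        (hc _ ((map_mem_fixer e).1 hα) _ ((map_mem_fixer e).1 hβ))
      rw [map_commutatorElement] at this
      have h2 : ∀ u : E'ˣ, (Units.mapEquiv e).toMonoidHom ((Units.mapEquiv e).symm u) = u :=
        (Units.mapEquiv e).apply_symm_apply
      rwa [h2, h2] at this
    · set F := Units.mapEquiv e
      have h1 : W.comap F.toMonoidHom ≤ V := by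
        intro x hx
        obtain ⟨y, hy, hyx⟩ := hWV hx
        rwa [← F.injective hyx]
      have hmap : (W.comap F.toMonoidHom).map F.toMonoidHom = W :=
        Subgroup.map_comap_eq_self_of_surjective F.surjective W
      rcases hi (F.symm t) ((map_mem_fixer e).1 ht) (by rw [← map_pow, htq, map_one])
        (by simpa using ht1) _ h1 (fun w hw => by
          have := hW _ hw
          simpa [Subgroup.mem_comap] using this) with h | h
      · left; rw [← hmap, h, Subgroup.map_bot]
      · right; rw [← hmap, h]

/-! ### Nilpotent groups, abelian groups of finite exponent, and recognition of cyclic groups. -/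

/-- Elements of coprime prime power orders commute in a nilpotent finite group. -/
theorem commute_of_pow_eq_one_of_isNilpotent {N : Type*} [Group N] [Finite N]
    [Group.IsNilpotent N] {p q : ℕ} (hp : p.Prime) (hq : q.Prime) (hpq : p ≠ q) {x y : N} {a b : ℕ}
    (hx : x ^ p ^ a = 1) (hy : y ^ q ^ b = 1) : Commute x y := by
  have := Fact.mk hp
  have := Fact.mk hq
  have aux : ∀ {r : ℕ} [Fact r.Prime] {z : N} {c : ℕ}, z ^ r ^ c = 1 →
      IsPGroup r (Subgroup.zpowers z) := by
    intro r hr z c hz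
    obtain ⟨k, -, hk⟩ := (Nat.dvd_prime_pow hr.out).1 (orderOf_dvd_of_pow_eq_one hz)
    exact IsPGroup.of_card (n := k) (by rw [Nat.card_zpowers, hk])
  obtain ⟨P, hP⟩ := (aux hx).exists_le_sylow
  obtain ⟨Q, hQ⟩ := (aux hy).exists_le_sylow
  exact Subgroup.commute_of_normal_of_disjoint _ _ inferInstance inferInstance
    (IsPGroup.disjoint_of_ne p q hpq _ _ P.isPGroup' Q.isPGroup') x y
    (hP (Subgroup.mem_zpowers x)) (hQ (Subgroup.mem_zpowers y))

/-- An element whose order is the exponent of an abelian group can be sent to any element of an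
arbitrary group that is killed by this exponent. -/
theorem exists_hom_apply_eq_of_orderOf {A X : Type*} [CommGroup A] [Group X] {n : ℕ} (hn : n ≠ 0)
    (hA : ∀ a : A, a ^ n = 1) {x : A} (hx : orderOf x = n) {y : X} (hy : y ^ n = 1) :
    ∃ f : A →* X, f x = y ∧ ∀ a, f a ∈ Subgroup.zpowers y := by
  have hn' : 0 < n := Nat.pos_of_ne_zero hn
  have hnQ : (n : ℚ) ≠ 0 := Nat.cast_ne_zero.2 hn
  -- The class of `1 / n` generates the `n`-torsion of `ℚ / ℤ`. Since `ℚ / ℤ` is injective, `x ↦ u`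
  -- extends to all of `A` with values in that torsion; composing with `u ↦ y` gives `f`.
  let u : AddCircle (1 : ℚ) := ((1 / n : ℚ) : AddCircle (1 : ℚ))
  have key : ∀ m : ℤ, m • u = 0 ↔ (n : ℤ) ∣ m := by
    intro m
    have : m • u = ((m / n : ℚ) : AddCircle (1 : ℚ)) := by
      rw [← AddCircle.coe_zsmul]; congr 1; simp [div_eq_mul_inv]
    rw [this, AddCircle.coe_eq_zero_iff]
    constructor
    · rintro ⟨k, hk⟩
      refine ⟨k, ?_⟩
      have : (m : ℚ) = n * k := by
        rw [zsmul_one] at hk; rw [hk]; field_simp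
      exact_mod_cast this
    · rintro ⟨k, rfl⟩
      exact ⟨k, by push_cast; rw [zsmul_one]; field_simp⟩
  have hxo : addOrderOf (Additive.ofMul x) = n := by rw [addOrderOf_ofMul_eq_orderOf, hx]
  obtain ⟨g₀, hg₀⟩ : ∃ g₀ : AddSubgroup.zmultiples (Additive.ofMul x) →+ AddCircle (1 : ℚ),
      g₀ ⟨Additive.ofMul x, AddSubgroup.mem_zmultiples _⟩ = u := by
    have hex : ∀ z : AddSubgroup.zmultiples (Additive.ofMul x), ∃ k : ℤ,
        k • Additive.ofMul x = z := fun z => AddSubgroup.mem_zmultiples_iff.1 z.2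
    choose k hk using hex
    have hwd : ∀ i j : ℤ, i • Additive.ofMul x = j • Additive.ofMul x → i • u = j • u := by
      intro i j hij
      rw [← sub_eq_zero, ← sub_smul, key, ← hxo, addOrderOf_dvd_iff_zsmul_eq_zero, sub_zsmul, hij,
        add_neg_cancel]
    refine ⟨AddMonoidHom.mk' (fun z => k z • u) fun z w => ?_, ?_⟩
    · rw [← add_zsmul]
      apply hwd
      rw [hk, add_zsmul, hk, hk]; rfl
    · change k _ • u = u
      conv_rhs => rw [← one_zsmul u]
      apply hwd
      rw [hk, one_zsmul]
  obtain ⟨c, hc⟩ := (Module.Baer.of_divisible (AddCircle (1 : ℚ))).extension_property_addMonoidHom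
    (AddSubgroup.zmultiples (Additive.ofMul x)).subtype Subtype.val_injective g₀
  have hcx : c (Additive.ofMul x) = u := by rw [← hg₀, ← hc]; rfl
  have hex : ∀ a : A, ∃ m : ℤ, m • u = c (Additive.ofMul a) := by
    intro a
    have h0 : n • c (Additive.ofMul a) = 0 := by
      rw [← map_nsmul, ← ofMul_pow, hA, ofMul_one, map_zero]
    obtain ⟨m, -, hm⟩ := (AddCircle.nsmul_eq_zero_iff hn').1 h0
    refine ⟨m, ?_⟩
    rw [← hm, ← AddCircle.coe_zsmul]; congr 1; simp [div_eq_mul_inv]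
  choose m hm using hex
  have hwd : ∀ i j : ℤ, i • u = j • u → y ^ i = y ^ j := by
    intro i j hij
    rw [← sub_eq_zero, ← sub_smul, key] at hij
    obtain ⟨k, hk⟩ := hij
    rw [← mul_inv_eq_one, ← zpow_sub, hk, zpow_mul, zpow_natCast, hy, one_zpow]
  refine ⟨MonoidHom.mk' (fun a => y ^ m a) fun a b => ?_, ?_, fun a => ⟨m a, rfl⟩⟩
  · rw [← zpow_add]
    apply hwd
    rw [hm, add_zsmul, hm, hm, ofMul_mul, map_add]
  · change y ^ m x = y
    conv_rhs => rw [← zpow_one y]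
    apply hwd
    rw [hm, one_zsmul, hcx]

/-- The ring is a quotient of the `q`-adic integers, a valuation ring, and divisibility passes to
quotients. -/
theorem zmod_prime_pow_dvd_total {q v : ℕ} (hq : q.Prime) (a b : ZMod (q ^ v)) :
    a ∣ b ∨ b ∣ a := by
  have := Fact.mk hq
  obtain ⟨x, rfl⟩ := ZMod.ringHom_surjective (PadicInt.toZModPow (p := q) v) a
  obtain ⟨y, rfl⟩ := ZMod.ringHom_surjective (PadicInt.toZModPow (p := q) v) b
  exact (ValuationRing.dvd_total x y).imp (map_dvd _) (map_dvd _)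

/-- A group whose endomorphism monoid is the multiplicative monoid of `ℤ / q ^ v` is cyclic of order
`q ^ v`. -/
theorem isCyclic_of_end_mulEquiv_zmod {K : Type*} [Group K] {q v : ℕ} (hq : q.Prime)
    (e : Monoid.End K ≃* ZMod (q ^ v)) : IsCyclic K ∧ Nat.card K = q ^ v := by
  have : NeZero (q ^ v) := ⟨(pow_pos hq.pos v).ne'⟩
  have hcomm : ∀ f g : Monoid.End K, f * g = g * f := fun f g =>
    e.injective (by rw [map_mul, map_mul, mul_comm])
  have htotal : ∀ f g : Monoid.End K, (∃ h, g = h * f) ∨ ∃ h, f = h * g := by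
    intro f g
    rcases zmod_prime_pow_dvd_total hq (e f) (e g) with ⟨c, hc⟩ | ⟨c, hc⟩
    · exact Or.inl ⟨e.symm c, e.injective (by rw [map_mul, e.apply_symm_apply, hc, mul_comm])⟩
    · exact Or.inr ⟨e.symm c, e.injective (by rw [map_mul, e.apply_symm_apply, hc, mul_comm])⟩
  -- Inner automorphisms commute with each other, so `K` has nilpotency class at most two.
  have hcen : ∀ x y : K, ⁅x, y⁆ ∈ Subgroup.center K := by
    intro x y
    rw [← innerUnit_eq_one_iff, map_commutatorElement, commutatorElement_eq_one_iff_mul_comm]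
    exact Units.ext (hcomm _ _)
  -- In class two, `f = ⁅·, x⁆` and `g = ⁅·, y⁆` are endomorphisms, and one is a left multiple of
  -- the other. If `g = h * f`, then `⁅x, y⁆ = h ⁅x, x⁆ = 1`.
  have habel : ∀ x y : K, x * y = y * x := by
    have hom : ∀ y : K, ∃ f : Monoid.End K, ∀ x, f x = ⁅x, y⁆ := by
      intro y
      refine ⟨toEnd (MonoidHom.mk' (fun x => ⁅x, y⁆) fun a b => ?_), fun x => rfl⟩
      have h := Subgroup.mem_center_iff.1 (hcen b y) a
      simp only [commutatorElement_def] at h ⊢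
      calc a * b * y * (a * b)⁻¹ * y⁻¹ = a * (b * y * b⁻¹ * y⁻¹) * (y * a⁻¹ * y⁻¹) := by group
        _ = _ := by rw [h]
        _ = b * y * b⁻¹ * y⁻¹ * (a * y * a⁻¹ * y⁻¹) := by group
        _ = _ := by
          have h' := Subgroup.mem_center_iff.1 (hcen b y) (a * y * a⁻¹ * y⁻¹)
          rw [commutatorElement_def] at h'
          exact h'.symm
    intro x y
    obtain ⟨f, hf⟩ := hom x
    obtain ⟨g, hg⟩ := hom y
    rcases htotal f g with ⟨h, rfl⟩ | ⟨h, rfl⟩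
    · have := hg x
      rw [monoidEnd_mul_apply, hf, commutatorElement_self, map_one] at this
      exact commutatorElement_eq_one_iff_mul_comm.1 this.symm
    · have := hf y
      rw [monoidEnd_mul_apply, hg, commutatorElement_self, map_one] at this
      exact (commutatorElement_eq_one_iff_mul_comm.1 this.symm).symm
  let : CommGroup K := { (inferInstance : Group K) with mul_comm := habel }
  have : Finite (Monoid.End K) := Finite.of_equiv _ e.symm.toEquiv
  have hexp : Monoid.ExponentExists K := by
    -- With finitely many endomorphisms, two power maps coincide.
    obtain ⟨a, b, hab, h⟩ := Finite.exists_ne_map_eq_of_infinite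
      (fun n : ℕ => toEnd (powMonoidHom n : K →* K))
    wlog hlt : a < b generalizing a b
    · exact this b a hab.symm h.symm (lt_of_le_of_ne (not_lt.1 hlt) hab.symm)
    refine ⟨b - a, Nat.sub_pos_of_lt hlt, fun g => ?_⟩
    have := DFunLike.congr_fun h g
    simp only [toEnd_apply, powMonoidHom_apply] at this
    rw [pow_sub _ hlt.le, ← this, mul_inv_cancel]
  obtain ⟨x, hx⟩ := Monoid.exists_orderOf_eq_exponent hexp
  obtain ⟨ρ, hρx, hρ⟩ := exists_hom_apply_eq_of_orderOf (Monoid.exponent_ne_zero.2 hexp)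
    Monoid.pow_exponent_eq_one hx (Monoid.pow_exponent_eq_one x)
  -- `ρ` retracts `K` onto `⟨x⟩`, and `ZMod (q ^ v)` has only the idempotents `0` and `1`. Hence
  -- either `x`, an element of maximal order, is trivial, or `⟨x⟩` is everything.
  have hidem : toEnd ρ * toEnd ρ = toEnd ρ := by
    ext a
    obtain ⟨k, hk⟩ := hρ a
    change ρ (ρ a) = ρ a
    simp only at hk
    rw [← hk, map_zpow, hρx]
  have hid : ∀ a : ZMod (q ^ v), a * a = a → a = 0 ∨ a = 1 := by
    intro a ha
    rcases zmod_prime_pow_dvd_total hq a (1 - a) with ⟨c, hc⟩ | ⟨c, hc⟩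
    · right
      have : 1 - a = 0 := by
        calc 1 - a = (1 - a) - (a - a * a) := by rw [ha]; ring
          _ = (1 - a) * (1 - a) := by ring
          _ = (a - a * a) * c := by nth_rewrite 2 [hc]; ring
          _ = 0 := by rw [ha]; ring
      exact (sub_eq_zero.1 this).symm
    · left
      calc a = a * a := ha.symm
        _ = (a - a * a) * c := by nth_rewrite 2 [hc]; ring
        _ = 0 := by rw [ha]; ring
  have hone : ∀ a : ZMod (q ^ v), (∀ b, b * a = a) → a = 0 := fun a h => by
    rw [← h 0, zero_mul]
  have h0 : e (toEnd 1) = 0 := hone _ fun b => by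
    obtain ⟨g, rfl⟩ := e.surjective b
    rw [← map_mul]
    congr 1
    ext a
    exact map_one g
  have hcyc : ∀ y : K, y ∈ Subgroup.zpowers x := by
    rcases hid (e (toEnd ρ)) (by rw [← map_mul, hidem]) with h | h
    · have : ρ = 1 := e.injective (h.trans h0.symm)
      have hx1 : x = 1 := by rw [← hρx, this]; rfl
      have : Monoid.exponent K = 1 := by rw [← hx, hx1, orderOf_one]
      intro y
      have hy := Monoid.pow_exponent_eq_one y
      rw [this, pow_one] at hy
      rw [hy]
      exact one_mem _
    · have : toEnd ρ = 1 := e.injective (h.trans (map_one e).symm)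
      intro y
      have hy := hρ y
      rwa [← toEnd_apply, this] at hy
  refine ⟨⟨x, hcyc⟩, ?_⟩
  rw [← Nat.card_zmod (q ^ v), ← Nat.card_congr e.toEquiv]
  refine (Nat.card_eq_of_bijective (fun f : Monoid.End K => f x) ⟨fun f g hfg => ?_,
    fun y => ?_⟩).symm
  · ext y
    obtain ⟨k, rfl⟩ := hcyc y
    simp only at hfg ⊢
    rw [map_zpow, map_zpow, hfg]
  · obtain ⟨k, rfl⟩ := hcyc y
    exact ⟨toEnd (zpowGroupHom k), rfl⟩

/-! ### Schur's lemma and irreducible actions. -/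

/-- If a finite abelian group is irreducible under an endomorphism `σ`, then the centralizer of `σ`
is a field. -/
theorem isField_centralizer_of_irreducible {A : Type*} [AddCommGroup A] [Finite A] [Nontrivial A]
    (σ : AddMonoid.End A)
    (hirr : ∀ W : AddSubgroup A, (∀ w ∈ W, σ w ∈ W) → W = ⊥ ∨ W = ⊤) :
    IsField (Subring.centralizer ({σ} : Set (AddMonoid.End A))) := by
  have hfin : Finite (AddMonoid.End A) :=
    Finite.of_injective (fun f : AddMonoid.End A => (f : A → A)) DFunLike.coe_injective
  obtain ⟨a, ha⟩ := exists_ne (0 : A)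
  have hnt : Nontrivial (AddMonoid.End A) :=
    ⟨1, 0, fun h => ha (DFunLike.congr_fun h a)⟩
  have hcomm : ∀ f : Subring.centralizer ({σ} : Set (AddMonoid.End A)), ∀ x,
      σ (f.1 x) = f.1 (σ x) := fun f x =>
    DFunLike.congr_fun (Subring.mem_centralizer_iff.1 f.2 σ rfl) x
  have hdom : NoZeroDivisors (Subring.centralizer ({σ} : Set (AddMonoid.End A))) := by
    refine ⟨fun {f g} hfg => ?_⟩
    -- The kernel of `f` is `σ`-invariant, so `f` is injective or zero. A finite ring without zero
    -- divisors is then a field by Wedderburn.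
    rcases hirr (AddMonoidHom.ker (show A →+ A from f.1)) (fun w hw => by
      have hw' : f.1 w = 0 := hw
      have h' : f.1 (σ w) = 0 := by rw [← hcomm, hw', map_zero]
      exact h') with h | h
    · right
      ext x
      have h1 : f.1 (g.1 x) = 0 := DFunLike.congr_fun (congrArg Subtype.val hfg) x
      have h2 : g.1 x ∈ AddMonoidHom.ker (show A →+ A from f.1) := h1
      rw [h] at h2
      exact h2
    · left
      ext x
      have h2 : x ∈ AddMonoidHom.ker (show A →+ A from f.1) := by rw [h]; trivial
      exact h2
  have : IsDomain (Subring.centralizer ({σ} : Set (AddMonoid.End A))) :=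
    NoZeroDivisors.to_isDomain _
  exact Finite.isDomain_to_isField _

/-- In a field, an element of prime order generates all roots of unity of this order. -/
theorem exists_pow_eq_of_isField {R : Type*} [Ring R] (hR : IsField R) {q : ℕ} (hq : q.Prime)
    {a b : R} (ha : a ^ q = 1) (ha1 : a ≠ 1) (hb : b ^ q = 1) : ∃ i : ℕ, a ^ i = b := by
  let : Field R := hR.toField
  have : NeZero q := ⟨hq.ne_zero⟩
  have : Fact q.Prime := ⟨hq⟩
  have hprim : IsPrimitiveRoot a q := by
    rw [← orderOf_eq_prime ha ha1]
    exact IsPrimitiveRoot.orderOf a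
  obtain ⟨i, -, hi⟩ := hprim.eq_pow_of_pow_eq_one hb
  exact ⟨i, hi⟩

section FrobeniusAction

variable {X : Type*} [Group X] {V S : Subgroup X} {s : X}

/-- The conjugation action of a subgroup `S` on a subgroup `V` that it normalizes. -/
def conjEnd (hSV : ∀ α ∈ S, ∀ w ∈ V, α * w * α⁻¹ ∈ V) :
    S →* AddMonoid.End (Additive V) where
  toFun α := AddMonoidHom.mk'
    (fun w => Additive.ofMul (⟨α.1 * w.toMul.1 * α.1⁻¹, hSV _ α.2 _ w.toMul.2⟩ : V))
    fun a b => congrArg Additive.ofMul (Subtype.ext (by simp [mul_assoc]))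
  map_one' := by
    ext w
    change (1 : X) * w.toMul.1 * 1⁻¹ = w.toMul.1
    simp
  map_mul' α β := by
    ext w
    change (α.1 * β.1) * w.toMul.1 * (α.1 * β.1)⁻¹ =
      α.1 * (β.1 * w.toMul.1 * β.1⁻¹) * α.1⁻¹
    group

/-- `S` embeds in the centralizer of the irreducible operator given by `s`, which is a field.
Multiplicative subgroups of a field are abelian, and its `q`-th roots of unity are the powers of any
nontrivial one. -/
theorem comm_and_exists_pow_of_irreducible [Finite V] {q : ℕ} (hq : q.Prime)
    (hV : ∀ a ∈ V, ∀ b ∈ V, a * b = b * a) (hs : s ∈ S) (hsq : s ^ q = 1) (hs1 : s ≠ 1)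
    (hSs : ∀ α ∈ S, α * s = s * α) (hSV : ∀ α ∈ S, ∀ w ∈ V, α * w * α⁻¹ ∈ V)
    (hfaith : ∀ α ∈ S, (∀ w ∈ V, α * w * α⁻¹ = w) → α = 1)
    (hirr : ∀ W ≤ V, (∀ w ∈ W, s * w * s⁻¹ ∈ W) → W = ⊥ ∨ W = V) :
    (∀ α ∈ S, ∀ β ∈ S, α * β = β * α) ∧
      ∀ α ∈ S, α ^ q = 1 → α ≠ 1 → ∃ i : ℕ, α ^ i = s := by
  let : CommGroup V := { (inferInstance : Group V) with
    mul_comm := fun a b => Subtype.ext (hV a a.2 b b.2) }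
  set ρ := conjEnd hSV with hρ
  have hinj : Function.Injective ρ := by
    rw [injective_iff_map_eq_one]
    intro α hα
    refine Subtype.ext (hfaith α α.2 fun w hw => ?_)
    have := DFunLike.congr_fun hα (Additive.ofMul (⟨w, hw⟩ : V))
    exact congrArg (fun z : Additive V => (z.toMul : X)) this
  let σ : S := ⟨s, hs⟩
  have hnt : Nontrivial (Additive V) := by
    by_contra h
    rw [not_nontrivial_iff_subsingleton] at h
    refine hs1 (congrArg Subtype.val (hinj (a₁ := σ) (a₂ := 1) ?_))
    ext w
    exact congrArg (fun z : Additive V => (z.toMul : X)) (Subsingleton.elim _ _)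
  have hirr' : ∀ W : AddSubgroup (Additive V), (∀ w ∈ W, ρ σ w ∈ W) → W = ⊥ ∨ W = ⊤ := by
    intro W hW
    set W' : Subgroup V := AddSubgroup.toSubgroup' W with hW'
    have hmem : ∀ w : V, w ∈ W' ↔ Additive.ofMul w ∈ W := fun w => Iff.rfl
    rcases hirr (W'.map V.subtype) (Subgroup.map_subtype_le W') (by
      rintro _ ⟨w, hw, rfl⟩
      exact ⟨_, hW _ hw, rfl⟩) with h | h
    · left
      rw [eq_bot_iff]
      intro w hw
      have h1 : (w.toMul : X) ∈ W'.map V.subtype := ⟨w.toMul, hw, rfl⟩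
      rw [h, Subgroup.mem_bot] at h1
      exact congrArg Additive.ofMul (Subtype.ext h1 : w.toMul = 1)
    · right
      rw [eq_top_iff]
      intro w _
      have h1 : (w.toMul : X) ∈ W'.map V.subtype := by
        rw [h]; exact w.toMul.2
      obtain ⟨w', hw', hww⟩ := h1
      rw [← ofMul_toMul w, ← Subtype.ext hww]
      exact hw'
  have hF := isField_centralizer_of_irreducible (A := Additive V) (ρ σ) hirr'
  have hcent : ∀ α : S, ρ α ∈ Subring.centralizer ({ρ σ} : Set (AddMonoid.End (Additive V))) := by
    intro α
    rw [Subring.mem_centralizer_iff]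
    rintro _ rfl
    rw [← map_mul, ← map_mul]
    exact congrArg ρ (Subtype.ext (hSs α α.2).symm)
  refine ⟨fun α hα β hβ => ?_, fun α hα hαq hα1 => ?_⟩
  · have := congrArg Subtype.val (hF.mul_comm ⟨_, hcent ⟨α, hα⟩⟩ ⟨_, hcent ⟨β, hβ⟩⟩)
    exact congrArg Subtype.val (hinj (a₁ := ⟨α, hα⟩ * ⟨β, hβ⟩) (a₂ := ⟨β, hβ⟩ * ⟨α, hα⟩)
      (by rw [map_mul, map_mul]; exact this))
  · have hpow : ∀ (β : S), β ^ q = 1 → (⟨ρ β, hcent β⟩ : Subring.centralizer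
        ({ρ σ} : Set (AddMonoid.End (Additive V)))) ^ q = 1 := fun β hβ =>
      Subtype.ext (by rw [SubmonoidClass.coe_pow, ← map_pow, hβ, map_one]; rfl)
    obtain ⟨i, hi⟩ := exists_pow_eq_of_isField hF hq (hpow ⟨α, hα⟩ (Subtype.ext hαq))
      (fun h => hα1 (congrArg Subtype.val (hinj (a₁ := ⟨α, hα⟩) (a₂ := 1)
        (by rw [map_one]; exact congrArg Subtype.val h))))
      (hpow σ (Subtype.ext hsq))
    refine ⟨i, congrArg Subtype.val (hinj (a₁ := ⟨α, hα⟩ ^ i) (a₂ := σ) ?_)⟩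
    rw [map_pow]
    exact congrArg Subtype.val hi

/-- Modulo `V` the elements of `Γ` become elements of the abelian group `S`. As `V` is abelian, `t =
w * α` acts on it as `α`, and some power of `α` is `s`, so a `t`-invariant subgroup is
`s`-invariant. -/
theorem commutator_mem_and_irreducible_of_decomposition [Finite V] {p q : ℕ} (hp : p.Prime)
    (hq : q.Prime) (hpq : p ≠ q) (hVp : IsPGroup p V)
    (hV : ∀ a ∈ V, ∀ b ∈ V, a * b = b * a) (hs : s ∈ S) (hsq : s ^ q = 1) (hs1 : s ≠ 1)
    (hSs : ∀ α ∈ S, α * s = s * α) (hSV : ∀ α ∈ S, ∀ w ∈ V, α * w * α⁻¹ ∈ V)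
    (hfaith : ∀ α ∈ S, (∀ w ∈ V, α * w * α⁻¹ = w) → α = 1)
    (hirr : ∀ W ≤ V, (∀ w ∈ W, s * w * s⁻¹ ∈ W) → W = ⊥ ∨ W = V)
    {Γ : Subgroup X} (hΓ : ∀ γ ∈ Γ, ∃ w ∈ V, ∃ α ∈ S, γ = w * α) :
    (∀ α ∈ Γ, ∀ β ∈ Γ, ⁅α, β⁆ ∈ V) ∧
      ∀ t ∈ Γ, t ^ q = 1 → t ≠ 1 → ∀ W ≤ V, (∀ w ∈ W, t * w * t⁻¹ ∈ W) → W = ⊥ ∨ W = V := by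
  obtain ⟨hcomm, hpow⟩ := comm_and_exists_pow_of_irreducible hq hV hs hsq hs1 hSs hSV hfaith hirr
  constructor
  · intro γ hγ δ hδ
    obtain ⟨w, hw, α, hα, rfl⟩ := hΓ γ hγ
    obtain ⟨u, hu, β, hβ, rfl⟩ := hΓ δ hδ
    have h : ⁅w * α, u * β⁆ = w * (α * u * α⁻¹) * (β * w⁻¹ * β⁻¹) * u⁻¹ := by
      have h1 : α * β * α⁻¹ = β := by rw [hcomm α hα β hβ, mul_inv_cancel_right]
      calc ⁅w * α, u * β⁆ = w * (α * u * α⁻¹) * ((α * β * α⁻¹) * w⁻¹ * β⁻¹) * u⁻¹ := by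
            rw [commutatorElement_def]; group
        _ = _ := by rw [h1]
    rw [h]
    exact V.mul_mem (V.mul_mem (V.mul_mem hw (hSV α hα u hu)) (hSV β hβ _ (V.inv_mem hw)))
      (V.inv_mem hu)
  · intro t ht htq ht1 W hWV hW
    obtain ⟨w, hw, α, hα, rfl⟩ := hΓ t ht
    have hmod : ∀ n : ℕ, ∃ u ∈ V, (w * α) ^ n = u * α ^ n := by
      intro n
      induction n with
      | zero => exact ⟨1, V.one_mem, by simp⟩
      | succ n ih =>
        obtain ⟨u, hu, hn⟩ := ih
        refine ⟨u * (α ^ n * w * (α ^ n)⁻¹), V.mul_mem hu (hSV _ (S.pow_mem hα n) w hw), ?_⟩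
        rw [pow_succ, hn]
        group
    -- `α ^ q` lies in the abelian group `V`, hence acts trivially on it and is trivial by
    -- faithfulness.
    have hαq : α ^ q = 1 := by
      obtain ⟨u, hu, hn⟩ := hmod q
      have hmem : α ^ q ∈ V := by
        rw [htq] at hn
        rw [← inv_eq_of_mul_eq_one_right hn.symm]
        exact V.inv_mem hu
      exact hfaith _ (S.pow_mem hα q) fun z hz => by
        rw [hV _ hmem z hz, mul_inv_cancel_right]
    have hα1 : α ≠ 1 := by
      rintro rfl
      rw [mul_one] at htq ht1
      obtain ⟨k, hk⟩ := hVp ⟨w, hw⟩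
      have hk' : w ^ p ^ k = 1 := congrArg Subtype.val hk
      have hcop : (p ^ k).gcd q = 1 := ((Nat.coprime_primes hp hq).2 hpq).pow_left k
      exact ht1 (by rw [← pow_one w, ← hcop]; exact pow_gcd_eq_one.2 ⟨hk', htq⟩)
    have hαW : ∀ z ∈ W, α * z * α⁻¹ ∈ W := by
      intro z hz
      have h1 := hW z hz
      have h2 : w * α * z * (w * α)⁻¹ = α * z * α⁻¹ := by
        calc w * α * z * (w * α)⁻¹ = w * (α * z * α⁻¹) * w⁻¹ := by group
          _ = _ := by rw [hV w hw _ (hSV α hα z (hWV hz)), mul_inv_cancel_right]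
      rwa [h2] at h1
    have hαiW : ∀ i : ℕ, ∀ z ∈ W, α ^ i * z * (α ^ i)⁻¹ ∈ W := by
      intro i
      induction i with
      | zero => intro z hz; simpa using hz
      | succ n ih =>
        intro z hz
        have := ih _ (hαW z hz)
        rwa [show α ^ n * (α * z * α⁻¹) * (α ^ n)⁻¹ = α ^ (n + 1) * z * (α ^ (n + 1))⁻¹ by
          rw [pow_succ]; group] at this
    obtain ⟨i, hi⟩ := hpow α hα hαq hα1
    exact hirr W hWV fun z hz => hi ▸ hαiW i z hz

end FrobeniusAction

/-! ### Structure of a Schmidt group. -/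

/-- A Schmidt group with parameters `p, q, v`, together with a generator `c` of a complement of its
derived subgroup and the projection `ε` onto this complement. -/
structure IsSchmidtProjection (p q v : ℕ) {G : Type*} [Group G] (c : G) (ε : G →* G) : Prop where
  finite : Finite G
  not_nilpotent : ¬ Group.IsNilpotent G
  nilpotent_of_ne_top : ∀ K : Subgroup G, K ≠ ⊤ → Group.IsNilpotent K
  prime_p : p.Prime
  prime_q : q.Prime
  p_ne_q : p ≠ q
  one_le_v : 1 ≤ v
  isPGroup_commutator : IsPGroup p (commutator G)
  orderOf_eq : orderOf c = q ^ v
  apply_eq_one_iff : ∀ x, ε x = 1 ↔ x ∈ commutator G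
  apply_gen : ε c = c
  apply_mem : ∀ x, ε x ∈ Subgroup.zpowers c

theorem IsSchmidtGroupWith.exists_projection {p q v : ℕ} {G : Type*} [Group G]
    (h : IsSchmidtGroupWith p q v G) : ∃ (c : G) (ε : G →* G), IsSchmidtProjection p q v c ε := by
  obtain ⟨C, hC, hcard, hcomp⟩ := h.exists_complement
  obtain ⟨c, hc⟩ := hC.exists_generator
  let e := hcomp.symm.QuotientMulEquiv
  refine ⟨c, C.subtype.comp (e.toMonoidHom.comp (QuotientGroup.mk' (commutator G))),
    h.isSchmidtGroup.finite, h.isSchmidtGroup.not_nilpotent,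
    h.isSchmidtGroup.nilpotent_of_ne_top, h.prime_p, h.prime_q, h.p_ne_q, h.one_le_v,
    h.isPGroup_commutator, ?_, ?_, ?_, ?_⟩
  · rw [Subgroup.orderOf_coe, ← hcard, orderOf_eq_card_of_forall_mem_zpowers hc]
  · intro x
    rw [← QuotientGroup.eq_one_iff x]
    change ((e (x : G ⧸ commutator G) : C) : G) = 1 ↔ _
    rw [OneMemClass.coe_eq_one, map_eq_one_iff e e.injective]
  · change ((e ((c : G) : G ⧸ commutator G) : C) : G) = c
    have : e ((c : G) : G ⧸ commutator G) = c := by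
      rw [← MulEquiv.eq_symm_apply]; rfl
    rw [this]
  · intro x
    obtain ⟨k, hk⟩ := hc (e (x : G ⧸ commutator G))
    refine ⟨k, ?_⟩
    change (c : G) ^ k = ((e (x : G ⧸ commutator G) : C) : G)
    simp only at hk
    rw [← hk]; rfl

namespace IsSchmidtProjection

variable {p q v : ℕ} {G : Type*} [Group G] {c : G} {ε : G →* G}

theorem apply_apply (h : IsSchmidtProjection p q v c ε) (x : G) : ε (ε x) = ε x := by
  obtain ⟨k, hk⟩ := h.apply_mem x
  simp only at hk
  rw [← hk, map_zpow, h.apply_gen]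

theorem mul_inv_apply_mem (h : IsSchmidtProjection p q v c ε) (x : G) :
    x * (ε x)⁻¹ ∈ commutator G := by
  rw [← h.apply_eq_one_iff, map_mul, map_inv, h.apply_apply, mul_inv_cancel]

theorem gen_pow (h : IsSchmidtProjection p q v c ε) : c ^ q ^ v = 1 := by
  rw [← h.orderOf_eq, pow_orderOf_eq_one]

theorem apply_pow (h : IsSchmidtProjection p q v c ε) (x : G) : (ε x) ^ q ^ v = 1 := by
  obtain ⟨k, hk⟩ := h.apply_mem x
  simp only at hk
  rw [← hk, ← zpow_natCast, zpow_comm, zpow_natCast, h.gen_pow, one_zpow]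

theorem exists_pow_eq_one (h : IsSchmidtProjection p q v c ε) {x : G} (hx : x ∈ commutator G) :
    ∃ a : ℕ, x ^ p ^ a = 1 := by
  obtain ⟨a, ha⟩ := h.isPGroup_commutator ⟨x, hx⟩
  exact ⟨a, congrArg Subtype.val ha⟩

theorem eq_one_of_pow_eq_one (h : IsSchmidtProjection p q v c ε) {x : G} (hx : x ∈ commutator G)
    (hxq : x ^ q ^ v = 1) : x = 1 := by
  obtain ⟨a, ha⟩ := h.exists_pow_eq_one hx
  have hcop : (p ^ a).gcd (q ^ v) = 1 :=
    ((Nat.coprime_primes h.prime_p h.prime_q).2 h.p_ne_q).pow a v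
  rw [← pow_one x, ← hcop]
  exact pow_gcd_eq_one.2 ⟨ha, hxq⟩

theorem exists_pow_eq_apply (h : IsSchmidtProjection p q v c ε) (x : G) : ∃ n : ℕ, c ^ n = ε x := by
  have := h.finite
  exact (Submonoid.mem_powers_iff _ _).1 ((mem_powers_iff_mem_zpowers).2 (h.apply_mem x))

theorem apply_comm (h : IsSchmidtProjection p q v c ε) (x y : G) : ε x * ε y = ε y * ε x := by
  obtain ⟨m, hm⟩ := h.exists_pow_eq_apply x
  obtain ⟨n, hn⟩ := h.exists_pow_eq_apply y
  rw [← hm, ← hn, ← pow_add, add_comm, pow_add]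

/-- Proper subgroups of the derived subgroup normalized by the generator of the complement are
centralized by it. -/
theorem commute_of_ne (h : IsSchmidtProjection p q v c ε) {W : Subgroup G}
    (hW : W ≤ commutator G) (hcW : ∀ w ∈ W, c * w * c⁻¹ ∈ W) (hne : W ≠ commutator G) {w : G}
    (hw : w ∈ W) : c * w = w * c := by
  have hpow : ∀ n : ℕ, ∀ w ∈ W, c ^ n * w * (c ^ n)⁻¹ ∈ W := by
    intro n
    induction n with
    | zero => intro z hz; simpa using hz
    | succ n ih =>
      intro z hz
      have := ih _ (hcW z hz)
      rwa [show c ^ n * (c * z * c⁻¹) * (c ^ n)⁻¹ = c ^ (n + 1) * z * (c ^ (n + 1))⁻¹ by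
        rw [pow_succ]; group] at this
  have hεW : ∀ g : G, ∀ w ∈ W, ε g * w * (ε g)⁻¹ ∈ W := by
    intro g w hw
    obtain ⟨n, hn⟩ := h.exists_pow_eq_apply g
    exact hn ▸ hpow n w hw
  -- This is the product `W⟨c⟩`, proper because `W ≠ G'`, hence nilpotent; so its `p`-elements
  -- commute with `c`.
  let S : Subgroup G :=
    { carrier := {g | g * (ε g)⁻¹ ∈ W}
      one_mem' := by simp
      mul_mem' := by
        intro a b ha hb
        simp only [Set.mem_ofPred_eq] at *
        have := W.mul_mem ha (hεW a _ hb)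
        rwa [show a * (ε a)⁻¹ * (ε a * (b * (ε b)⁻¹) * (ε a)⁻¹) = a * b * (ε (a * b))⁻¹ by
          rw [map_mul]; group] at this
      inv_mem' := by
        intro a ha
        simp only [Set.mem_ofPred_eq] at *
        have := hεW a⁻¹ _ (W.inv_mem ha)
        rwa [show ε a⁻¹ * (a * (ε a)⁻¹)⁻¹ * (ε a⁻¹)⁻¹ = a⁻¹ * (ε a⁻¹)⁻¹ by
          rw [map_inv]; group] at this }
  have hmem : ∀ g, g ∈ S ↔ g * (ε g)⁻¹ ∈ W := fun g => Iff.rfl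
  have hS : S ≠ ⊤ := by
    intro htop
    refine hne (le_antisymm hW fun x hx => ?_)
    have hxS : x ∈ S := htop ▸ Subgroup.mem_top x
    rwa [hmem, (h.apply_eq_one_iff x).2 hx, inv_one, mul_one] at hxS
  have := h.nilpotent_of_ne_top S hS
  have := h.finite
  have hcS : c ∈ S := by rw [hmem, h.apply_gen, mul_inv_cancel]; exact W.one_mem
  have hwS : w ∈ S := by
    rwa [hmem, (h.apply_eq_one_iff w).2 (hW hw), inv_one, mul_one]
  obtain ⟨a, ha⟩ := h.exists_pow_eq_one (hW hw)
  have hcomm := commute_of_pow_eq_one_of_isNilpotent h.prime_p h.prime_q h.p_ne_q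
    (x := (⟨w, hwS⟩ : S)) (y := ⟨c, hcS⟩) (a := a) (b := v) (Subtype.ext ha)
    (Subtype.ext h.gen_pow)
  exact (congrArg Subtype.val hcomm).symm

/-- The preimage of `⟨c ^ q⟩` under `ε` is proper, hence nilpotent, and contains `G'`; so `c ^ q`
centralizes `G'`. -/
theorem gen_pow_mem_center (h : IsSchmidtProjection p q v c ε) : c ^ q ∈ Subgroup.center G := by
  let S : Subgroup G := (Subgroup.zpowers (c ^ q)).comap ε
  have hmem : ∀ g, g ∈ S ↔ ε g ∈ Subgroup.zpowers (c ^ q) := fun g => Iff.rfl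
  have hS : S ≠ ⊤ := by
    intro htop
    have hcS : c ∈ S := htop ▸ Subgroup.mem_top c
    rw [hmem, h.apply_gen] at hcS
    obtain ⟨k, hk⟩ := hcS
    have h1 : c ^ q ^ (v - 1) = 1 := by
      have h2 : (c ^ q) ^ q ^ (v - 1) = 1 := by
        rw [← pow_mul, ← pow_succ', Nat.sub_add_cancel h.one_le_v, h.gen_pow]
      simp only at hk
      rw [← hk, ← zpow_natCast, zpow_comm, zpow_natCast, h2, one_zpow]
    have h3 := orderOf_dvd_of_pow_eq_one h1
    rw [h.orderOf_eq, Nat.pow_dvd_pow_iff_le_right h.prime_q.one_lt] at h3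
    have := h.one_le_v
    omega
  have := h.nilpotent_of_ne_top S hS
  have := h.finite
  have hcS : c ^ q ∈ S := by
    rw [hmem, map_pow, h.apply_gen]; exact Subgroup.mem_zpowers _
  have hP : ∀ x ∈ commutator G, x * c ^ q = c ^ q * x := by
    intro x hx
    have hxS : x ∈ S := by
      rw [hmem, (h.apply_eq_one_iff x).2 hx]; exact one_mem _
    obtain ⟨a, ha⟩ := h.exists_pow_eq_one hx
    have hcomm := commute_of_pow_eq_one_of_isNilpotent h.prime_p h.prime_q h.p_ne_q
      (x := (⟨x, hxS⟩ : S)) (y := ⟨c ^ q, hcS⟩) (a := a) (b := v) (Subtype.ext ha)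
      (Subtype.ext (by
        change (c ^ q) ^ q ^ v = 1
        rw [← pow_mul, mul_comm, pow_mul, h.gen_pow, one_pow]))
    exact congrArg Subtype.val hcomm
  rw [Subgroup.mem_center_iff]
  intro g
  have h1 := hP _ (h.mul_inv_apply_mem g)
  have h2 : ε g * c ^ q = c ^ q * ε g := by
    rw [← h.apply_gen, ← map_pow]; exact h.apply_comm _ _
  calc g * c ^ q = g * (ε g)⁻¹ * (ε g * c ^ q) := by group
    _ = (g * (ε g)⁻¹ * c ^ q) * ε g := by rw [h2]; group
    _ = c ^ q * g := by rw [h1]; group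

theorem isNilpotent_commutator (h : IsSchmidtProjection p q v c ε) :
    Group.IsNilpotent (commutator G) := by
  have := h.finite
  have := Fact.mk h.prime_p
  exact h.isPGroup_commutator.isNilpotent

/-- Otherwise `⟨c⟩` is central with quotient an image of the nilpotent group `G'`, making `G`
nilpotent. -/
theorem exists_not_commute (h : IsSchmidtProjection p q v c ε) :
    ∃ x ∈ commutator G, c * x ≠ x * c := by
  by_contra! hall
  have hcen : c ∈ Subgroup.center G := by
    rw [Subgroup.mem_center_iff]
    intro g
    have h1 := hall _ (h.mul_inv_apply_mem g)
    obtain ⟨n, hn⟩ := h.exists_pow_eq_apply g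
    calc g * c = (g * (ε g)⁻¹) * (ε g * c) := by group
      _ = (g * (ε g)⁻¹ * c) * ε g := by rw [← hn, ← pow_succ, pow_succ']; group
      _ = c * g := by rw [← h1]; group
  have hle : Subgroup.zpowers c ≤ Subgroup.center G := by
    rwa [Subgroup.zpowers_le]
  have hnorm : (Subgroup.zpowers c).Normal := ⟨fun n hn g => by
    rw [Subgroup.mem_center_iff.1 (hle hn) g, mul_inv_cancel_right]; exact hn⟩
  have := h.isNilpotent_commutator
  have hq : Group.IsNilpotent (G ⧸ Subgroup.zpowers c) := by
    refine Group.nilpotent_of_surjective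
      ((QuotientGroup.mk' (Subgroup.zpowers c)).comp (commutator G).subtype) fun y => ?_
    obtain ⟨g, rfl⟩ := QuotientGroup.mk_surjective y
    refine ⟨⟨_, h.mul_inv_apply_mem g⟩, ?_⟩
    change ((g * (ε g)⁻¹ : G) : G ⧸ Subgroup.zpowers c) = g
    rw [QuotientGroup.eq]
    simpa using h.apply_mem g
  exact h.not_nilpotent (Subgroup.isNilpotent_of_ker_le_center (QuotientGroup.mk' (Subgroup.zpowers c))
    (by rw [QuotientGroup.ker_mk']; exact hle))

/-- The commutators of the elements of the derived subgroup with the generator of the complement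
lie in no proper subgroup of the derived subgroup normalized by that generator. -/
theorem eq_commutator_of_forall_mem (h : IsSchmidtProjection p q v c ε) {W : Subgroup G}
    (hW : W ≤ commutator G) (hcW : ∀ w ∈ W, c * w * c⁻¹ ∈ W)
    (hgen : ∀ x ∈ commutator G, x⁻¹ * c * x * c⁻¹ ∈ W) : W = commutator G := by
  by_contra hne
  obtain ⟨x, hx, hnc⟩ := h.exists_not_commute
  set w := x⁻¹ * c * x * c⁻¹ with hw
  have hwc : c * w = w * c := h.commute_of_ne hW hcW hne (hgen x hx)
  -- Coprime action: `c` centralizes `w`, so conjugating `n` times multiplies `x` by `w ^ n`. At `n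
  -- = q ^ v` this gives `w ^ q ^ v = 1`, impossible for a nontrivial `p`-element.
  have hpow : ∀ n : ℕ, c ^ n * x * (c ^ n)⁻¹ = x * w ^ n := by
    intro n
    induction n with
    | zero => simp
    | succ n ih =>
      have hcn : c * w ^ n * c⁻¹ = w ^ n := by
        rw [(show Commute c w from hwc).pow_right n, mul_inv_cancel_right]
      calc c ^ (n + 1) * x * (c ^ (n + 1))⁻¹ = c * (c ^ n * x * (c ^ n)⁻¹) * c⁻¹ := by
            rw [pow_succ']; group
        _ = (c * x * c⁻¹) * (c * w ^ n * c⁻¹) := by rw [ih]; group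
        _ = x * w ^ (n + 1) := by rw [hcn, pow_succ', ← mul_assoc]; congr 1; rw [hw]; group
  have h1 := hpow (q ^ v)
  rw [h.gen_pow, one_mul, inv_one, mul_one] at h1
  have hw1 : w = 1 := h.eq_one_of_pow_eq_one (hW (hgen x hx)) (by simpa using h1.symm)
  apply hnc
  have h2 : x * w * c = c * x := by rw [hw]; group
  rw [← h2, hw1, mul_one]

theorem commutator_commutator_ne (h : IsSchmidtProjection p q v c ε) :
    ⁅commutator G, commutator G⁆ ≠ commutator G := by
  have := h.isNilpotent_commutator
  have hsol : Group.IsSolvable (commutator G) := inferInstance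
  have : Group.IsSolvable G := by
    refine Group.isSolvable_of_ker_le_range (commutator G).subtype (Abelianization.of (G := G)) ?_
    rw [Abelianization.ker_of, Subgroup.range_subtype]
  have hne : commutator G ≠ ⊥ := by
    intro hbot
    obtain ⟨x, hx, hnc⟩ := h.exists_not_commute
    rw [hbot, Subgroup.mem_bot] at hx
    exact hnc (by rw [hx, one_mul, mul_one])
  exact (Group.IsSolvable.commutator_lt_of_ne_bot hne).ne

theorem commute_commutator (h : IsSchmidtProjection p q v c ε) {x y : G} (hx : x ∈ commutator G)
    (hy : y ∈ commutator G) : c * ⁅x, y⁆ = ⁅x, y⁆ * c := by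
  refine h.commute_of_ne (W := ⁅commutator G, commutator G⁆) (Subgroup.commutator_le_right _ _)
    (fun w hw => ?_) h.commutator_commutator_ne (Subgroup.commutator_mem_commutator hx hy)
  exact (inferInstance : (⁅commutator G, commutator G⁆ : Subgroup G).Normal).conj_mem w hw c

/-- The centralizer of `d` in `G'` is `c`-invariant. It contains each `x⁻¹ * c * x * c⁻¹`: since `c`
fixes both `d` and `⁅x, d⁆`, the elements `x` and `c * x * c⁻¹` conjugate `d` identically. So it is
all of `G'`. -/
theorem mem_center_of_commute (h : IsSchmidtProjection p q v c ε) {d : G}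
    (hd : d ∈ commutator G) (hcd : c * d = d * c) : d ∈ Subgroup.center G := by
  have hconj : c * d * c⁻¹ = d := by rw [hcd, mul_inv_cancel_right]
  have hconj' : c * d⁻¹ * c⁻¹ = d⁻¹ := by
    rw [← conj_inv, hconj]
  have hW : commutator G ⊓ Subgroup.centralizer {d} = commutator G := by
    refine h.eq_commutator_of_forall_mem inf_le_left (fun w hw => ?_) fun x hx => ?_
    · refine Subgroup.mem_inf.2 ⟨Subgroup.commutator_normal _ _ |>.conj_mem w hw.1 c, ?_⟩
      have h1 := Subgroup.mem_centralizer_singleton_iff.1 hw.2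
      rw [Subgroup.mem_centralizer_singleton_iff]
      calc c * w * c⁻¹ * d = c * w * c⁻¹ * (c * d * c⁻¹) := by rw [hconj]
        _ = c * (w * d) * c⁻¹ := by group
        _ = (c * d * c⁻¹) * (c * w * c⁻¹) := by rw [h1]; group
        _ = d * (c * w * c⁻¹) := by rw [hconj]
    · have hcx : c * x * c⁻¹ ∈ commutator G := Subgroup.commutator_normal _ _ |>.conj_mem x hx c
      refine Subgroup.mem_inf.2 ⟨?_, ?_⟩
      · have := (commutator G).mul_mem ((commutator G).inv_mem hx) hcx
        rwa [show x⁻¹ * (c * x * c⁻¹) = x⁻¹ * c * x * c⁻¹ by group] at this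
      · have h1 := h.commute_commutator hx hd
        have h2 : (c * x * c⁻¹) * d * (c * x * c⁻¹)⁻¹ = x * d * x⁻¹ := by
          calc (c * x * c⁻¹) * d * (c * x * c⁻¹)⁻¹
              = (c * x * c⁻¹) * (c * d * c⁻¹) * (c * x * c⁻¹)⁻¹ * (c * d⁻¹ * c⁻¹) * d := by
                rw [hconj, hconj']; group
            _ = c * ⁅x, d⁆ * c⁻¹ * d := by rw [commutatorElement_def]; group
            _ = x * d * x⁻¹ := by rw [h1, commutatorElement_def]; group
        rw [Subgroup.mem_centralizer_singleton_iff]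
        calc x⁻¹ * c * x * c⁻¹ * d
            = x⁻¹ * ((c * x * c⁻¹) * d * (c * x * c⁻¹)⁻¹) * (c * x * c⁻¹) := by group
          _ = d * (x⁻¹ * c * x * c⁻¹) := by rw [h2]; group
  rw [Subgroup.mem_center_iff]
  intro g
  have h1 : ∀ x ∈ commutator G, x * d = d * x := fun x hx =>
    Subgroup.mem_centralizer_singleton_iff.1 (Subgroup.mem_inf.1 (hW.symm ▸ hx)).2
  have h2 : ε g * d = d * ε g := by
    obtain ⟨n, hn⟩ := h.exists_pow_eq_apply g
    rw [← hn]
    exact (show Commute c d from hcd).pow_left n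
  calc g * d = g * (ε g)⁻¹ * (ε g * d) := by group
    _ = (g * (ε g)⁻¹ * d) * ε g := by rw [h2]; group
    _ = d * g := by rw [h1 _ (h.mul_inv_apply_mem g)]; group

/-- The image of `f` is proper, hence nilpotent, so `f c` commutes with `f x` for `x` in `G'`. The
kernel therefore contains all `x⁻¹ * c * x * c⁻¹`, which forces it to contain `G'`. -/
theorem apply_eq_one_of_not_isUnit (h : IsSchmidtProjection p q v c ε) (f : Monoid.End G)
    (hf : ¬ IsUnit f) {x : G} (hx : x ∈ commutator G) : f x = 1 := by
  have := h.finite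
  let F : G →* G := f
  have hr : F.range ≠ ⊤ := fun htop => hf (isUnit_monoidEnd_of_bijective f
    (Finite.injective_iff_bijective.1 (Finite.injective_iff_surjective.2
      (MonoidHom.range_eq_top.1 htop))))
  have := h.nilpotent_of_ne_top _ hr
  have hcomm : ∀ x ∈ commutator G, F c * F x = F x * F c := by
    intro x hx
    obtain ⟨a, ha⟩ := h.exists_pow_eq_one hx
    have := commute_of_pow_eq_one_of_isNilpotent h.prime_p h.prime_q h.p_ne_q
      (x := F.rangeRestrict x) (y := F.rangeRestrict c) (a := a) (b := v)
      (by rw [← map_pow, ha, map_one]) (by rw [← map_pow, h.gen_pow, map_one])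
    exact (congrArg Subtype.val this).symm
  have hcn : ∀ x ∈ commutator G, c * x * c⁻¹ ∈ commutator G :=
    fun x hx => Subgroup.commutator_normal _ _ |>.conj_mem x hx c
  have hW : commutator G ⊓ F.ker = commutator G := by
    refine h.eq_commutator_of_forall_mem inf_le_left (fun w hw => Subgroup.mem_inf.2 ⟨hcn w hw.1, ?_⟩)
      fun x hx => Subgroup.mem_inf.2 ⟨?_, ?_⟩
    · exact F.normal_ker.conj_mem w hw.2 c
    · have := (commutator G).mul_mem ((commutator G).inv_mem hx) (hcn x hx)
      rwa [show x⁻¹ * (c * x * c⁻¹) = x⁻¹ * c * x * c⁻¹ by group] at this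
    · rw [MonoidHom.mem_ker, map_mul, map_mul, map_mul, map_inv, map_inv, mul_assoc _ (F c) (F x),
        hcomm x hx]
      group
  exact (Subgroup.mem_inf.1 (hW.symm ▸ hx)).2

theorem exists_conj_apply_eq (h : IsSchmidtProjection p q v c ε) {y : G} (hy : y ^ q ^ v = 1) :
    ∃ x ∈ commutator G, ε (x * y * x⁻¹) = x * y * x⁻¹ := by
  have := h.finite
  have := Fact.mk h.prime_p
  have := Fact.mk h.prime_q
  have aux : ∀ z : G, z ^ q ^ v = 1 → IsPGroup q (Subgroup.zpowers z) := by
    intro z hz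
    obtain ⟨k, -, hk⟩ := (Nat.dvd_prime_pow h.prime_q).1 (orderOf_dvd_of_pow_eq_one hz)
    exact IsPGroup.of_card (n := k) (by rw [Nat.card_zpowers, hk])
  obtain ⟨Q, hQ⟩ := (aux c h.gen_pow).exists_le_sylow
  obtain ⟨R, hR⟩ := (aux y hy).exists_le_sylow
  have hQmem : ∀ g ∈ Q, ε g = g := by
    intro g hg
    have hεg : ε g ∈ Q := by
      obtain ⟨n, hn⟩ := h.exists_pow_eq_apply g
      exact hn ▸ Q.pow_mem (hQ (Subgroup.mem_zpowers c)) n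
    have hm : g * (ε g)⁻¹ ∈ Q := Q.mul_mem hg (Q.inv_mem hεg)
    have hdis := IsPGroup.disjoint_of_ne p q h.p_ne_q (commutator G) Q h.isPGroup_commutator
      Q.isPGroup'
    exact (mul_inv_eq_one.1 (Subgroup.disjoint_def.1 hdis (h.mul_inv_apply_mem g) hm)).symm
  obtain ⟨g, hg⟩ := MulAction.exists_smul_eq G R Q
  have hgy : g * y * g⁻¹ ∈ Q := by
    rw [← hg]
    exact Subgroup.smul_mem_pointwise_smul y (MulAut.conj g) (R : Subgroup G)
      (hR (Subgroup.mem_zpowers y))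
  have h1 := hQmem _ hgy
  -- Dividing the Sylow conjugator by its `⟨c⟩`-component moves it into `G'` and keeps the conjugate
  -- in `⟨c⟩`.
  refine ⟨(ε g)⁻¹ * g, ?_, ?_⟩
  · rw [← h.apply_eq_one_iff, map_mul, map_inv, h.apply_apply, inv_mul_cancel]
  · have h2 : (ε g)⁻¹ * g * y * ((ε g)⁻¹ * g)⁻¹ = (ε g)⁻¹ * (g * y * g⁻¹) * ε g := by group
    simp only [h2]
    rw [map_mul, map_mul, map_inv, h.apply_apply, h1]

end IsSchmidtProjection

/-! ### The profile of the projection of a Schmidt group. -/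

namespace IsSchmidtProjection

variable {p q v : ℕ} {G : Type*} [Group G] {c : G} {ε : G →* G}

theorem mem_fixer_iff_apply {α : (Monoid.End G)ˣ} :
    α ∈ fixer (toEnd ε) ↔ ∀ g, ε ((α : Monoid.End G) g) = ε g :=
  ⟨fun h g => DFunLike.congr_fun h g, fun h => by ext g; exact h g⟩

theorem monoidEnd_ext_of_commutator (h : IsSchmidtProjection p q v c ε) {f g : Monoid.End G}
    (hP : ∀ x ∈ commutator G, f x = g x) (hc : f c = g c) : f = g := by
  ext x
  have hε : f (ε x) = g (ε x) := by
    obtain ⟨n, hn⟩ := h.exists_pow_eq_apply x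
    rw [← hn, map_pow, map_pow, hc]
  change f x = g x
  rw [← inv_mul_cancel_right x (ε x), map_mul f, map_mul g, hP _ (h.mul_inv_apply_mem x), hε]

theorem innerUnit_mem_fixer (h : IsSchmidtProjection p q v c ε) (x : G) :
    innerUnit G x ∈ fixer (toEnd ε) := by
  rw [mem_fixer_iff_apply]
  intro g
  rw [innerUnit_apply, map_mul, map_mul, map_inv, h.apply_comm x g, mul_inv_cancel_right]

/-- By Sylow some `x` in `G'` conjugates `α c` into `⟨c⟩`; since `α` preserves `ε`, the result is
`c` itself. -/
theorem exists_innerUnit_mul (h : IsSchmidtProjection p q v c ε) {α : (Monoid.End G)ˣ}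
    (hα : α ∈ fixer (toEnd ε)) :
    ∃ x ∈ commutator G, (α : Monoid.End G) c = x⁻¹ * c * x := by
  obtain ⟨x, hx, hxe⟩ := h.exists_conj_apply_eq (y := (α : Monoid.End G) c)
    (by rw [← map_pow, h.gen_pow, map_one])
  refine ⟨x, hx, ?_⟩
  rw [map_mul, map_mul, map_inv, (h.apply_eq_one_iff x).2 hx, mem_fixer_iff_apply.1 hα,
    h.apply_gen, one_mul, inv_one, mul_one] at hxe
  have h1 : x⁻¹ * (x * (α : Monoid.End G) c * x⁻¹) * x = (α : Monoid.End G) c := by group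
  rw [← h1, ← hxe]

theorem exists_corner (h : IsSchmidtProjection p q v c ε) :
    ∃ φ : ZMod (q ^ v) → Monoid.End G, Function.Injective φ ∧
      (∀ a b, φ (a * b) = φ a * φ b) ∧ φ 1 = toEnd ε ∧
      (∀ f, toEnd ε * f = f → f * toEnd ε = f → ∃ a, φ a = f) ∧
      ∀ a, ¬ IsUnit a → ∀ α ∈ fixer (toEnd ε), (α : Monoid.End G) * φ a = φ a := by
  have hnz : NeZero (q ^ v) := ⟨(pow_pos h.prime_q.pos v).ne'⟩
  have hex : ∀ n : ℕ, ∃ f : Monoid.End G, ∀ g, f g = ε g ^ n := fun n =>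
    ⟨toEnd (MonoidHom.mk' (fun g => ε g ^ n) fun a b => by
      rw [map_mul, (show Commute (ε a) (ε b) from h.apply_comm a b).mul_pow]), fun g => rfl⟩
  choose ψ hψ using hex
  have hmod : ∀ (m n : ℕ), (m : ZMod (q ^ v)) = n → ∀ g, ε g ^ m = ε g ^ n := by
    intro m n hmn g
    rw [ZMod.natCast_eq_natCast_iff] at hmn
    exact pow_eq_pow_iff_modEq.2 (hmn.of_dvd (orderOf_dvd_of_pow_eq_one (h.apply_pow g)))
  -- The residue `a` acts as `g ↦ ε g ^ a`. For a non-unit `a` the values lie in `⟨c ^ q⟩`, which is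
  -- central and so fixed by any `α` sending `c` to a conjugate.
  refine ⟨fun a => ψ a.val, fun a b hab => ?_, fun a b => ?_, ?_, fun f hl hr => ?_,
    fun a ha α hα => ?_⟩
  · have h1 := DFunLike.congr_fun hab c
    simp only at h1
    rw [hψ, hψ, h.apply_gen, pow_eq_pow_iff_modEq, h.orderOf_eq,
      ← ZMod.natCast_eq_natCast_iff] at h1
    simpa using h1
  · ext g
    change ψ _ g = ψ _ (ψ _ g)
    rw [hψ, hψ, hψ, map_pow, h.apply_apply, ← pow_mul]
    refine hmod _ _ ?_ g
    rw [Nat.cast_mul, ZMod.natCast_zmod_val, ZMod.natCast_zmod_val, ZMod.natCast_zmod_val, mul_comm]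
  · ext g
    change ψ _ g = ε g
    rw [hψ]
    conv_rhs => rw [← pow_one (ε g)]
    exact hmod _ _ (by simp) g
  · have h1 : ε (f c) = f c := DFunLike.congr_fun hl c
    have h2 : ∀ g, f (ε g) = f g := fun g => DFunLike.congr_fun hr g
    obtain ⟨n, hn⟩ := h.exists_pow_eq_apply (f c)
    refine ⟨n, h.monoidEnd_ext_of_commutator (fun x hx => ?_) ?_⟩
    · rw [hψ, ← h2 x, (h.apply_eq_one_iff x).2 hx, map_one, one_pow]
    · rw [hψ, ← h1, ← hn, ← h.apply_gen, h.apply_apply]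
      exact hmod _ _ (by simp) c
  · have hdvd : q ∣ a.val := by
      by_contra hnd
      apply ha
      rw [← ZMod.natCast_zmod_val a, ZMod.isUnit_iff_coprime]
      exact (((Nat.Prime.coprime_iff_not_dvd h.prime_q).2 hnd).symm).pow_right v
    obtain ⟨m, hm⟩ := hdvd
    have hq : (α : Monoid.End G) (c ^ q) = c ^ q := by
      obtain ⟨x, -, hx⟩ := h.exists_innerUnit_mul hα
      have hcen := Subgroup.mem_center_iff.1 h.gen_pow_mem_center x⁻¹
      calc (α : Monoid.End G) (c ^ q) = (x⁻¹ * c * x⁻¹⁻¹) ^ q := by rw [map_pow, hx, inv_inv]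
        _ = c ^ q := by rw [conj_pow, hcen, mul_inv_cancel_right]
    ext g
    change (α : Monoid.End G) (ψ _ g) = ψ _ g
    obtain ⟨n, hn⟩ := h.exists_pow_eq_apply g
    have : ε g ^ a.val = (c ^ q) ^ (n * m) := by
      rw [← hn, ← pow_mul, ← pow_mul, hm]; congr 1; ring
    rw [hψ, this, map_pow, hq]

theorem exists_translations (h : IsSchmidtProjection p q v c ε) :
    ∃ V : Subgroup (Monoid.End G)ˣ, IsPGroup p V ∧
      (∀ α ∈ fixer (toEnd ε), ∀ β ∈ fixer (toEnd ε), ⁅α, β⁆ ∈ V) ∧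
      ∀ t ∈ fixer (toEnd ε), t ^ q = 1 → t ≠ 1 → ∀ W ≤ V, (∀ w ∈ W, t * w * t⁻¹ ∈ W) →
        W = ⊥ ∨ W = V := by
  have := h.finite
  have : Finite ((commutator G).map (innerUnit G)) :=
    Set.Finite.image (innerUnit G) (commutator G : Set G).toFinite
  -- The stabilizer of `c` in `fixer ε` complements the inner automorphisms by `G'`.
  let S : Subgroup (Monoid.End G)ˣ :=
    { carrier := {α | α ∈ fixer (toEnd ε) ∧ (α : Monoid.End G) c = c}
      one_mem' := ⟨one_mem _, rfl⟩
      mul_mem' := fun {a b} ha hb => ⟨mul_mem ha.1 hb.1, by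
        rw [Units.val_mul, monoidEnd_mul_apply, hb.2, ha.2]⟩
      inv_mem' := fun {a} ha => ⟨inv_mem ha.1, by
        conv_lhs => rw [← ha.2]
        exact unit_inv_apply_self a c⟩ }
  have hcn : ∀ x ∈ commutator G, c * x * c⁻¹ ∈ commutator G :=
    fun x hx => Subgroup.commutator_normal _ _ |>.conj_mem x hx c
  have hαP : ∀ α ∈ fixer (toEnd ε), ∀ x ∈ commutator G,
      (α : Monoid.End G) x ∈ commutator G := by
    intro α hα x hx
    rw [← h.apply_eq_one_iff] at hx ⊢
    rw [mem_fixer_iff_apply.1 hα, hx]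
  have hs1 : innerUnit G c ≠ 1 := by
    intro h1
    obtain ⟨x, -, hx⟩ := h.exists_not_commute
    exact hx (Subgroup.mem_center_iff.1 ((innerUnit_eq_one_iff c).1 h1) x).symm
  refine ⟨(commutator G).map (innerUnit G), h.isPGroup_commutator.map _,
    commutator_mem_and_irreducible_of_decomposition (S := S) (s := innerUnit G c) h.prime_p
      h.prime_q h.p_ne_q (h.isPGroup_commutator.map _) ?_ ⟨h.innerUnit_mem_fixer c, ?_⟩ ?_ hs1
      ?_ ?_ ?_ ?_ ?_⟩
  · rintro _ ⟨x, hx, rfl⟩ _ ⟨y, hy, rfl⟩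
    rw [← commutatorElement_eq_one_iff_mul_comm, ← map_commutatorElement, innerUnit_eq_one_iff]
    exact h.mem_center_of_commute (Subgroup.commutator_le_right _ _
      (Subgroup.commutator_mem_commutator (Subgroup.mem_top x) hy)) (h.commute_commutator hx hy)
  · rw [innerUnit_apply, mul_inv_cancel_right]
  · rw [← map_pow, innerUnit_eq_one_iff]
    exact h.gen_pow_mem_center
  · rintro α ⟨-, hα⟩
    have := unit_conj_innerUnit α c
    rw [hα] at this
    rw [← mul_inv_eq_iff_eq_mul, this]
  · rintro α ⟨hα, -⟩ _ ⟨x, hx, rfl⟩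
    rw [unit_conj_innerUnit]
    exact ⟨_, hαP α hα x hx, rfl⟩
  · rintro α ⟨hα, hαc⟩ hfix
    have hcen : ∀ x ∈ commutator G, x⁻¹ * (α : Monoid.End G) x ∈ Subgroup.center G := by
      intro x hx
      have := hfix _ ⟨x, hx, rfl⟩
      rw [unit_conj_innerUnit] at this
      rw [← innerUnit_eq_one_iff, map_mul, map_inv, this, inv_mul_cancel]
    -- Faithfulness: `α` moves each `x` in `G'` by a central factor, so it fixes every `x⁻¹ * c * x
    -- * c⁻¹`; its fixed points then exhaust `G'`.
    let W : Subgroup G :=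
      commutator G ⊓ MonoidHom.eqLocus (show G →* G from (α : Monoid.End G)) (MonoidHom.id G)
    have hmem : ∀ x, x ∈ W ↔ x ∈ commutator G ∧ (α : Monoid.End G) x = x := fun x => Iff.rfl
    have hW : W = commutator G := by
      refine h.eq_commutator_of_forall_mem inf_le_left (fun w hw => ?_) fun x hx => ?_
      · rw [hmem] at hw ⊢
        exact ⟨hcn w hw.1, by rw [map_mul, map_mul, map_inv, hαc, hw.2]⟩
      · rw [hmem]
        constructor
        · have := (commutator G).mul_mem ((commutator G).inv_mem hx) (hcn x hx)
          rwa [show x⁻¹ * (c * x * c⁻¹) = x⁻¹ * c * x * c⁻¹ by group] at this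
        · obtain ⟨d, hd⟩ : ∃ d, d = x⁻¹ * (α : Monoid.End G) x := ⟨_, rfl⟩
          have hdc : d * (x⁻¹ * c * x * c⁻¹) = (x⁻¹ * c * x * c⁻¹) * d :=
            (Subgroup.mem_center_iff.1 (hd ▸ hcen x hx) _).symm
          have hdc' : d * c⁻¹ = c⁻¹ * d :=
            (Subgroup.mem_center_iff.1 (hd ▸ hcen x hx) _).symm
          have hx' : (α : Monoid.End G) x = x * d := by rw [hd]; group
          rw [map_mul, map_mul, map_mul, map_inv, map_inv, hαc, hx']
          calc (x * d)⁻¹ * c * (x * d) * c⁻¹ = d⁻¹ * (x⁻¹ * c * x) * (d * c⁻¹) := by group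
            _ = d⁻¹ * ((x⁻¹ * c * x * c⁻¹) * d) := by rw [hdc']; group
            _ = x⁻¹ * c * x * c⁻¹ := by rw [← hdc]; group
    refine Units.ext (h.monoidEnd_ext_of_commutator (fun x hx => ?_) hαc)
    rw [← hW, hmem] at hx
    exact hx.2
  · intro W hWV hW
    -- A proper `c`-invariant preimage in `G'` is centralized by `c`, hence central, and gives only
    -- the trivial inner automorphism.
    by_cases hW' : (commutator G ⊓ W.comap (innerUnit G)) = commutator G
    · right
      refine le_antisymm hWV ?_
      rintro _ ⟨x, hx, rfl⟩
      have hx' : x ∈ commutator G ⊓ W.comap (innerUnit G) := by rwa [hW']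
      exact (Subgroup.mem_inf.1 hx').2
    · left
      rw [eq_bot_iff]
      intro w hw
      obtain ⟨x, hx, rfl⟩ := hWV hw
      rw [Subgroup.mem_bot, innerUnit_eq_one_iff]
      refine h.mem_center_of_commute hx (h.commute_of_ne inf_le_left (fun z hz => ?_) hW'
        (Subgroup.mem_inf.2 ⟨hx, hw⟩))
      obtain ⟨hz1, hz2⟩ := Subgroup.mem_inf.1 hz
      refine Subgroup.mem_inf.2 ⟨hcn z hz1, ?_⟩
      have := hW _ hz2
      rwa [← map_inv, ← map_mul, ← map_mul] at this
  · intro γ hγ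
    obtain ⟨x, hx, hxc⟩ := h.exists_innerUnit_mul hγ
    refine ⟨innerUnit G x⁻¹, ⟨x⁻¹, inv_mem hx, rfl⟩, innerUnit G x * γ,
      ⟨mul_mem (h.innerUnit_mem_fixer x) hγ, ?_⟩, ?_⟩
    · rw [Units.val_mul, monoidEnd_mul_apply, innerUnit_apply, hxc]; group
    · rw [map_inv, inv_mul_cancel_left]

theorem endProfile (h : IsSchmidtProjection p q v c ε) : EndProfile p q v (toEnd ε) := by
  have := h.finite
  have habs : ∀ f : Monoid.End G, ¬ IsUnit f → f * toEnd ε = f := by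
    intro f hf
    ext x
    have h1 := h.apply_eq_one_of_not_isUnit f hf (h.mul_inv_apply_mem x)
    rw [map_mul, map_inv, mul_inv_eq_one] at h1
    exact h1.symm
  refine ⟨?_, ?_, ?_, habs, h.exists_corner, fun f hf => ?_, h.exists_translations⟩
  · exact Finite.of_injective (fun f : Monoid.End G => (f : G → G)) DFunLike.coe_injective
  · ext x
    exact h.apply_apply x
  · intro hu
    obtain ⟨x, hx, hnc⟩ := h.exists_not_commute
    have h1 : toEnd ε x = toEnd ε 1 := by
      rw [map_one]; exact (h.apply_eq_one_iff x).2 hx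
    rw [injective_of_isUnit_monoidEnd hu h1, mul_one, one_mul] at hnc
    exact hnc rfl
  · have hfc : ∀ g, f (ε g) = f g := fun g => DFunLike.congr_fun (habs f hf) g
    obtain ⟨x, hx, hxe⟩ := h.exists_conj_apply_eq (y := f c)
      (by rw [← map_pow, h.gen_pow, map_one])
    refine ⟨innerUnit G x⁻¹, h.innerUnit_mem_fixer _, ?_⟩
    rw [← map_inv, inv_inv]
    refine h.monoidEnd_ext_of_commutator (fun y hy => ?_) hxe
    have : f y = 1 := by rw [← hfc, (h.apply_eq_one_iff y).2 hy, map_one]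
    simp only [monoidEnd_mul_apply, this, map_one]

end IsSchmidtProjection

/-! ### Reconstruction of `H` from the profile. -/

/-- An idempotent endomorphism `ε` of a group with the features listed in `EndProfile`, together
with a generator `k` of its image. -/
structure IsEndProjection (p q v : ℕ) {H : Type*} [Group H] (k : H) (ε : Monoid.End H) :
    Prop where
  profile : EndProfile p q v ε
  prime_p : p.Prime
  prime_q : q.Prime
  p_ne_q : p ≠ q
  one_le_v : 1 ≤ v
  orderOf_eq : orderOf k = q ^ v
  apply_gen : ε k = k
  apply_mem : ∀ x, ε x ∈ Subgroup.zpowers k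

/-- The corner `ε * End H * ε` is the endomorphism monoid of the image of `ε`, so that image is
cyclic of order `q ^ v`. -/
theorem EndProfile.exists_isEndProjection {p q v : ℕ} {H : Type*} [Group H] {ε : Monoid.End H}
    (h : EndProfile p q v ε) (hp : p.Prime) (hq : q.Prime) (hpq : p ≠ q) (hv : 1 ≤ v) :
    ∃ k, IsEndProjection p q v k ε := by
  obtain ⟨φ, hinj, hmul, hone, hsurj, -⟩ := h.corner
  let F : H →* H := ε
  have hidem : ∀ x, F (F x) = F x := fun x => DFunLike.congr_fun h.idem x
  have hF : ∀ x : F.range, F x = x := by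
    rintro ⟨_, y, rfl⟩
    exact hidem y
  let θ : Monoid.End F.range → Monoid.End H := fun g =>
    toEnd (F.range.subtype.comp ((show F.range →* F.range from g).comp F.rangeRestrict))
  have hθ : ∀ g x, θ g x = (g (F.rangeRestrict x) : H) := fun g x => rfl
  have hFr : ∀ x : F.range, F.rangeRestrict x = x := fun x => Subtype.ext (hF x)
  have hA : ∀ g, ∃ a, φ a = θ g := by
    intro g
    apply hsurj
    · ext x
      exact hF _
    · ext x
      change θ g (F x) = θ g x
      rw [hθ, hθ]
      congr 2
      exact Subtype.ext (hidem x)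
  choose A hA using hA
  have hAmul : ∀ g g', A (g * g') = A g * A g' := by
    intro g g'
    apply hinj
    rw [hmul, hA, hA, hA]
    ext x
    change ((g (g' (F.rangeRestrict x)) : F.range) : H) =
      g (F.rangeRestrict (g' (F.rangeRestrict x) : F.range))
    rw [hFr]
  have hbij : Function.Bijective A := by
    constructor
    · intro g g' hgg
      have h1 : θ g = θ g' := by rw [← hA, ← hA, hgg]
      ext x
      have h2 := DFunLike.congr_fun h1 (x : H)
      rw [hθ, hθ, hFr] at h2
      exact h2
    · intro a
      have hcl : ∀ x, F (φ a x) = φ a x := by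
        intro x
        have : ε * φ a = φ a := by rw [← hone, ← hmul, one_mul]
        exact DFunLike.congr_fun this x
      have hcr : ∀ x, φ a (F x) = φ a x := by
        intro x
        have : φ a * ε = φ a := by rw [← hone, ← hmul, mul_one]
        exact DFunLike.congr_fun this x
      let g : Monoid.End F.range := toEnd (((show H →* H from φ a).comp F.range.subtype).codRestrict
        F.range fun x => ⟨_, hcl x⟩)
      refine ⟨g, hinj ?_⟩
      rw [hA]
      ext x
      exact hcr x
  let e : Monoid.End F.range ≃* ZMod (q ^ v) :=
    MulEquiv.ofBijective ({ toFun := A, map_mul' := hAmul } : Monoid.End F.range →ₙ* ZMod (q ^ v))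
      hbij
  obtain ⟨hcyc, hcard⟩ := isCyclic_of_end_mulEquiv_zmod hq e
  obtain ⟨k, hk⟩ := hcyc.exists_generator
  refine ⟨k, h, hp, hq, hpq, hv, ?_, hF k, fun x => ?_⟩
  · rw [Subgroup.orderOf_coe, orderOf_eq_card_of_forall_mem_zpowers hk, hcard]
  · obtain ⟨n, hn⟩ := hk (F.rangeRestrict x)
    exact ⟨n, congrArg Subtype.val hn⟩

namespace IsEndProjection

variable {p q v : ℕ} {H : Type*} [Group H] {k : H} {ε : Monoid.End H}

theorem gen_pow (h : IsEndProjection p q v k ε) : k ^ q ^ v = 1 := by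
  rw [← h.orderOf_eq, pow_orderOf_eq_one]

theorem gen_ne_one (h : IsEndProjection p q v k ε) : k ≠ 1 := by
  intro hk
  have h1 := h.orderOf_eq
  rw [hk, orderOf_one] at h1
  have := Nat.one_lt_pow (Nat.one_le_iff_ne_zero.1 h.one_le_v) h.prime_q.one_lt
  omega

theorem apply_apply (h : IsEndProjection p q v k ε) (x : H) : ε (ε x) = ε x :=
  DFunLike.congr_fun h.profile.idem x

theorem apply_mul_inv (h : IsEndProjection p q v k ε) (x : H) : ε (x * (ε x)⁻¹) = 1 := by
  rw [map_mul, map_inv, h.apply_apply, mul_inv_cancel]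

theorem exists_pow_eq_apply (h : IsEndProjection p q v k ε) (x : H) : ∃ n : ℕ, k ^ n = ε x := by
  have hfin : IsOfFinOrder k := by
    rw [← orderOf_pos_iff, h.orderOf_eq]
    exact pow_pos h.prime_q.pos v
  exact (Submonoid.mem_powers_iff _ _).1 (hfin.mem_powers_iff_mem_zpowers.2 (h.apply_mem x))

theorem apply_comm (h : IsEndProjection p q v k ε) (x y : H) : ε x * ε y = ε y * ε x := by
  obtain ⟨m, hm⟩ := h.exists_pow_eq_apply x
  obtain ⟨n, hn⟩ := h.exists_pow_eq_apply y
  rw [← hm, ← hn, ← pow_add, add_comm, pow_add]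

theorem mem_fixer_iff_apply {α : (Monoid.End H)ˣ} :
    α ∈ fixer ε ↔ ∀ g, ε ((α : Monoid.End H) g) = ε g :=
  ⟨fun h g => DFunLike.congr_fun h g, fun h => by ext g; exact h g⟩

theorem innerUnit_mem_fixer (h : IsEndProjection p q v k ε) (x : H) : innerUnit H x ∈ fixer ε := by
  rw [mem_fixer_iff_apply]
  intro g
  rw [innerUnit_apply, map_mul, map_mul, map_inv, h.apply_comm x g, mul_inv_cancel_right]

theorem apply_eq_one_of_not_isUnit (h : IsEndProjection p q v k ε) {f : Monoid.End H}
    (hf : ¬ IsUnit f) {m : H} (hm : ε m = 1) : f m = 1 := by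
  have h1 : f (ε m) = f m := DFunLike.congr_fun (h.profile.absorb f hf) m
  rw [← h1, hm, map_one]

theorem not_isUnit_of_apply_gen (h : IsEndProjection p q v k ε) {f : Monoid.End H}
    (hf : f k = 1) : ¬ IsUnit f := fun hu =>
  h.gen_ne_one (injective_of_isUnit_monoidEnd hu (by rw [hf, map_one]))

theorem eq_one_of_forall_apply (h : IsEndProjection p q v k ε) : ¬ ∀ m, ε m = 1 → m = 1 := by
  intro hall
  apply h.profile.not_isUnit
  have : ε = 1 := by
    ext x
    have := hall _ (h.apply_mul_inv x)
    rw [mul_inv_eq_one] at this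
    exact this.symm
  rw [this]
  exact isUnit_one

/-- In an abelian `H` the map `x ↦ x * (ε x)⁻¹` is an endomorphism killing `k`. As a non-unit it
would kill the nontrivial kernel of `ε`, on which it is the identity. -/
theorem exists_not_commute (h : IsEndProjection p q v k ε) : ¬ ∀ x y : H, x * y = y * x := by
  intro hcomm
  have hmmm : ∀ x y z w : H, x * y * (z * w) = x * z * (y * w) := by
    intro x y z w
    rw [mul_assoc, ← mul_assoc y, hcomm y z]
    simp only [mul_assoc]
  let δ : Monoid.End H := toEnd (MonoidHom.mk' (fun x => x * (ε x)⁻¹) fun a b => by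
    rw [map_mul, hcomm (ε a), mul_inv_rev, hmmm])
  have hδ : ∀ x, δ x = x * (ε x)⁻¹ := fun x => rfl
  refine h.eq_one_of_forall_apply fun m hm => ?_
  have := h.apply_eq_one_of_not_isUnit
    (h.not_isUnit_of_apply_gen (f := δ) (by rw [hδ, h.apply_gen, mul_inv_cancel])) hm
  rwa [hδ, hm, inv_one, mul_one] at this

theorem ker_innerUnit : (innerUnit H).ker = Subgroup.center H := by
  ext x
  rw [MonoidHom.mem_ker, innerUnit_eq_one_iff]

theorem finite_range_innerUnit (h : IsEndProjection p q v k ε) : Finite (innerUnit H).range := by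
  have := h.profile.finite
  infer_instance

theorem finiteIndex_center (h : IsEndProjection p q v k ε) : (Subgroup.center H).FiniteIndex := by
  have := h.finite_range_innerUnit
  rw [← ker_innerUnit]
  exact Subgroup.finiteIndex_ker _

/-- The transfer into the centre is a power map. It is not onto because `H` is nonabelian, so it
kills the kernel of `ε`. -/
theorem pow_index_center_eq_one (h : IsEndProjection p q v k ε) {m : H} (hm : ε m = 1) :
    m ^ (Subgroup.center H).index = 1 := by
  have := h.finiteIndex_center
  let τ : Monoid.End H := toEnd ((Subgroup.center H).subtype.comp (MonoidHom.transferCenterPow H))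
  have hτ : ¬ IsUnit τ := by
    intro hu
    apply h.exists_not_commute
    intro x y
    obtain ⟨z, rfl⟩ := surjective_of_isUnit_monoidEnd hu x
    exact (Subgroup.mem_center_iff.1 (MonoidHom.transferCenterPow H z).2 y).symm
  exact h.apply_eq_one_of_not_isUnit hτ hm

theorem mem_commutator_iff (h : IsEndProjection p q v k ε) {m : H} :
    m ∈ commutator H ↔ ε m = 1 := by
  have hfi := h.finiteIndex_center
  have hn0 : (Subgroup.center H).index ≠ 0 := hfi.index_ne_zero
  constructor
  · intro hm
    have hle : commutator H ≤ MonoidHom.ker (show H →* H from ε) := by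
      rw [commutator_def, Subgroup.commutator_le]
      intro x _ y _
      rw [MonoidHom.mem_ker, map_commutatorElement, commutatorElement_eq_one_iff_mul_comm]
      exact h.apply_comm x y
    exact hle hm
  · intro hm
    -- The range of `δ` is the image of the kernel of `ε` in the abelianization, and the goal is
    -- that its exponent `n` is `1`.
    let δ : H →* Abelianization H :=
      MonoidHom.mk' (fun x => Abelianization.of x * (Abelianization.of (ε x))⁻¹) fun a b => by
        rw [map_mul, map_mul, map_mul, mul_inv]
        exact mul_mul_mul_comm _ _ _ _
    have hδ : ∀ x, δ x = Abelianization.of (x * (ε x)⁻¹) := fun x => by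
      rw [map_mul, map_inv]; rfl
    have hexp : ∀ a : δ.range, a ^ (Subgroup.center H).index = 1 := by
      rintro ⟨_, x, rfl⟩
      refine Subtype.ext ?_
      change (δ x) ^ _ = 1
      rw [hδ, ← map_pow, h.pow_index_center_eq_one (h.apply_mul_inv x), map_one]
    have hee : Monoid.ExponentExists δ.range := ⟨_, Nat.pos_of_ne_zero hn0, hexp⟩
    obtain ⟨x, hx⟩ := Monoid.exists_orderOf_eq_exponent hee
    obtain ⟨z, hz⟩ := x.2
    set n := Monoid.exponent δ.range with hn
    have hne : n ≠ 0 := Monoid.exponent_ne_zero.2 hee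
    set w := z * (ε z)⁻¹ with hw
    have hεw : ε w = 1 := h.apply_mul_inv z
    have hδw : δ w = δ z := by
      rw [hδ, hδ, hεw, inv_one, mul_one]
    have hord : orderOf (δ z) = n := by rw [hz, Subgroup.orderOf_coe, hx]
    have hwfin : 0 < orderOf w := by
      rw [orderOf_pos_iff, isOfFinOrder_iff_pow_eq_one]
      exact ⟨_, Nat.pos_of_ne_zero hn0, h.pow_index_center_eq_one hεw⟩
    have hdvd : n ∣ orderOf w := by
      rw [← hord, ← hδw]
      exact orderOf_map_dvd δ w
    have hy : orderOf (w ^ (orderOf w / n)) = n := orderOf_pow_orderOf_div hwfin.ne' hdvd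
    obtain ⟨f, hf, -⟩ := exists_hom_apply_eq_of_orderOf hne
      (fun a : δ.range => Monoid.pow_exponent_eq_one a) hx
      (y := w ^ (orderOf w / n)) (by rw [← orderOf_dvd_iff_pow_eq_one, hy])
    -- `ψ` kills `k`, so it is a non-unit and kills `w`; but it sends `w` to an element of order
    -- `n`.
    let ψ : Monoid.End H := toEnd (f.comp δ.rangeRestrict)
    have hψk : ψ k = 1 := by
      have : δ.rangeRestrict k = 1 := Subtype.ext (by
        change δ k = 1
        rw [hδ, h.apply_gen, mul_inv_cancel, map_one])
      change f (δ.rangeRestrict k) = 1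
      rw [this, map_one]
    have hψw := h.apply_eq_one_of_not_isUnit (h.not_isUnit_of_apply_gen hψk) hεw
    have h1 : ψ w = w ^ (orderOf w / n) := by
      rw [← hf]
      exact congrArg f (Subtype.ext (hδw.trans hz))
    have hn1 : n = 1 := by rw [← hy, ← h1, hψw, orderOf_one]
    have h2 := Monoid.pow_exponent_eq_one (δ.rangeRestrict m)
    rw [← hn, hn1, pow_one] at h2
    have h3 : δ m = 1 := congrArg Subtype.val h2
    rw [hδ, hm, inv_one, mul_one] at h3
    rwa [← Abelianization.ker_of, MonoidHom.mem_ker]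

/-- Commutators depend only on cosets of the centre, so there are finitely many; Schur's theorem
applies. -/
theorem finite_commutator (h : IsEndProjection p q v k ε) : Finite (commutator H) := by
  have := h.finiteIndex_center
  have hfin : Finite (H ⧸ Subgroup.center H) := Subgroup.finite_quotient_of_finiteIndex
  have : Finite (commutatorSet H) := by
    refine (Set.finite_range fun x : (H ⧸ Subgroup.center H) × (H ⧸ Subgroup.center H) =>
      ⁅x.1.out, x.2.out⁆).subset ?_
    rintro _ ⟨a, b, rfl⟩
    refine ⟨(a, b), ?_⟩
    obtain ⟨y, hy⟩ := QuotientGroup.mk_out_eq_mul (Subgroup.center H) a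
    obtain ⟨z, hz⟩ := QuotientGroup.mk_out_eq_mul (Subgroup.center H) b
    have hy' := Subgroup.mem_center_iff.1 y.2
    have hz' := Subgroup.mem_center_iff.1 z.2
    simp only [hy, hz, commutatorElement_def]
    calc a * y * (b * z) * (a * y)⁻¹ * (b * z)⁻¹
        = a * (y * (b * z)) * y.1⁻¹ * a⁻¹ * (b * z)⁻¹ := by group
      _ = a * b * (z * a⁻¹) * z.1⁻¹ * b⁻¹ := by rw [← hy' (b * z)]; group
      _ = a * b * a⁻¹ * b⁻¹ := by rw [← hz' a⁻¹]; group
  infer_instance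

theorem finite (h : IsEndProjection p q v k ε) : Finite H := by
  have h1 := h.finite_commutator
  have h2 : Finite (Subgroup.zpowers k) := Nat.finite_of_card_ne_zero (by
    rw [Nat.card_zpowers, h.orderOf_eq]
    exact (pow_pos h.prime_q.pos v).ne')
  refine Finite.of_surjective (fun x : commutator H × Subgroup.zpowers k => (x.1 * x.2 : H))
    fun x => ⟨(⟨_, h.mem_commutator_iff.2 (h.apply_mul_inv x)⟩, ⟨_, h.apply_mem x⟩), ?_⟩
  simp

/-- This replaces Sylow conjugacy: `k ↦ y`, precomposed with `ε`, is a non-unit, to which the `conj`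
clause applies. -/
theorem exists_unit_apply_inv (h : IsEndProjection p q v k ε) {y : H} (hy : y ^ q ^ v = 1) :
    ∃ α ∈ fixer ε, ε ((↑α⁻¹ : Monoid.End H) y) = (↑α⁻¹ : Monoid.End H) y := by
  let : CommGroup (Subgroup.zpowers k) := IsCyclic.commGroup
  have hexp : ∀ a : Subgroup.zpowers k, a ^ q ^ v = 1 := by
    rintro ⟨_, n, rfl⟩
    refine Subtype.ext ?_
    change (k ^ n) ^ q ^ v = 1
    rw [← zpow_natCast, zpow_comm, zpow_natCast, h.gen_pow, one_zpow]
  obtain ⟨f, hf, -⟩ := exists_hom_apply_eq_of_orderOf (pow_pos h.prime_q.pos v).ne' hexp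
    (x := ⟨k, Subgroup.mem_zpowers k⟩) (by rw [Subgroup.orderOf_mk, h.orderOf_eq]) hy
  let g : Monoid.End H := toEnd (f.comp ((show H →* H from ε).codRestrict _ h.apply_mem))
  have hg : g k = y := by
    rw [← hf]
    exact congrArg f (Subtype.ext h.apply_gen)
  have hgε : ∀ m, ε m = 1 → g m = 1 := by
    intro m hm
    have : (show H →* H from ε).codRestrict _ h.apply_mem m = 1 := Subtype.ext hm
    change f _ = 1
    rw [this, map_one]
  obtain ⟨α, hα, hαg⟩ := h.profile.conj g fun hu => h.eq_one_of_forall_apply fun m hm =>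
    injective_of_isUnit_monoidEnd hu (by rw [hgε m hm, map_one])
  refine ⟨α, hα, ?_⟩
  rw [← hg]
  exact DFunLike.congr_fun hαg k

theorem eq_one_of_pow_prime (h : IsEndProjection p q v k ε) {m : H} (hm : ε m = 1)
    (hmq : m ^ q = 1) : m = 1 := by
  obtain ⟨α, hα, hαm⟩ := h.exists_unit_apply_inv (y := m) (by
    obtain ⟨u, rfl⟩ := Nat.exists_eq_add_of_le h.one_le_v
    rw [pow_add, pow_one, pow_mul, hmq, one_pow])
  rw [mem_fixer_iff_apply.1 (inv_mem hα), hm] at hαm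
  rw [← unit_apply_inv_self α m, ← hαm, map_one]

theorem apply_gen_pow (h : IsEndProjection p q v k ε) {α : (Monoid.End H)ˣ} (hα : α ∈ fixer ε) :
    (α : Monoid.End H) (k ^ q) = k ^ q := by
  obtain ⟨φ, -, hmul, hone, hsurj, hfix⟩ := h.profile.corner
  let κ : Monoid.End H := toEnd (MonoidHom.mk' (fun x => ε x ^ q) fun a b => by
    rw [map_mul, (show Commute (ε a) (ε b) from h.apply_comm a b).mul_pow])
  have hκ : ∀ x, κ x = ε x ^ q := fun x => rfl
  obtain ⟨a, ha⟩ := hsurj κ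
    (by ext x; change ε (κ x) = κ x; rw [hκ, map_pow, h.apply_apply])
    (by ext x; change κ (ε x) = κ x; rw [hκ, hκ, h.apply_apply])
  -- If `a` were a unit, `k` would be a `q`-th power in `⟨k⟩`.
  have hau : ¬ IsUnit a := by
    rintro ⟨u, rfl⟩
    have h1 : κ * φ ↑u⁻¹ = ε := by rw [← ha, ← hmul, Units.mul_inv, hone]
    have h2 : ε (φ ↑u⁻¹ k) ^ q = k := by
      rw [← hκ, ← monoidEnd_mul_apply, h1, h.apply_gen]
    have h3 : k ^ q ^ (v - 1) = 1 := by
      obtain ⟨n, hn⟩ := h.exists_pow_eq_apply (φ ↑u⁻¹ k)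
      rw [← h2, ← hn, ← pow_mul, ← pow_mul, ← pow_succ',
        Nat.sub_add_cancel h.one_le_v, mul_comm n, pow_mul, h.gen_pow, one_pow]
    have h4 := orderOf_dvd_of_pow_eq_one h3
    rw [h.orderOf_eq, Nat.pow_dvd_pow_iff_le_right h.prime_q.one_lt] at h4
    have := h.one_le_v
    omega
  have h1 := DFunLike.congr_fun (hfix a hau α hα) k
  rw [ha, monoidEnd_mul_apply, hκ, h.apply_gen] at h1
  exact h1

theorem gen_pow_mem_center (h : IsEndProjection p q v k ε) : k ^ q ∈ Subgroup.center H := by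
  rw [Subgroup.mem_center_iff]
  intro g
  have := h.apply_gen_pow (h.innerUnit_mem_fixer g)
  rwa [innerUnit_apply, mul_inv_eq_iff_eq_mul] at this

theorem mem_center_of_commute (h : IsEndProjection p q v k ε)
    (hk : ∀ m, ε m = 1 → k * m = m * k) : k ∈ Subgroup.center H := by
  rw [Subgroup.mem_center_iff]
  intro g
  obtain ⟨n, hn⟩ := h.exists_pow_eq_apply g
  have h1 := hk _ (h.apply_mul_inv g)
  calc g * k = (g * (ε g)⁻¹) * (ε g * k) := by group
    _ = (g * (ε g)⁻¹ * k) * ε g := by rw [← hn, ← pow_succ, pow_succ']; group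
    _ = k * g := by rw [← h1]; group

theorem innerUnit_mem (h : IsEndProjection p q v k ε) {V : Subgroup (Monoid.End H)ˣ}
    (hV : ∀ α ∈ fixer ε, ∀ β ∈ fixer ε, ⁅α, β⁆ ∈ V) {m : H} (hm : ε m = 1) :
    innerUnit H m ∈ V := by
  have hle : commutator H ≤ V.comap (innerUnit H) := by
    rw [commutator_def, Subgroup.commutator_le]
    intro x _ y _
    rw [Subgroup.mem_comap, map_commutatorElement]
    exact hV _ (h.innerUnit_mem_fixer x) _ (h.innerUnit_mem_fixer y)
  exact hle (h.mem_commutator_iff.2 hm)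

/-- With `k` central, all inner automorphisms come from the kernel of `ε` and lie in the `p`-group
`V`, so `H` is nilpotent. But then also `H' = H''`, forcing `H' = 1`. -/
theorem gen_not_mem_center (h : IsEndProjection p q v k ε) : k ∉ Subgroup.center H := by
  intro hk
  have := Fact.mk h.prime_p
  have := h.finite_range_innerUnit
  obtain ⟨V, hVp, hV, -⟩ := h.profile.translations
  have hεc : ∀ x y, ε x * y = y * ε x := by
    intro x y
    obtain ⟨n, hn⟩ := h.exists_pow_eq_apply x
    rw [← hn]
    exact (Subgroup.mem_center_iff.1 (Subgroup.pow_mem _ hk n) y).symm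
  have hrange : (innerUnit H).range ≤ V := by
    rintro _ ⟨x, rfl⟩
    have h1 : innerUnit H (ε x) = 1 := by
      rw [innerUnit_eq_one_iff, Subgroup.mem_center_iff]
      exact fun y => (hεc x y).symm
    have h2 := h.innerUnit_mem hV (h.apply_mul_inv x)
    rwa [map_mul, map_inv, h1, inv_one, mul_one] at h2
  have : Group.IsNilpotent (innerUnit H).range := (hVp.to_le hrange).isNilpotent
  have : Group.IsNilpotent H := Subgroup.isNilpotent_of_ker_le_center (innerUnit H).rangeRestrict
    (by rw [MonoidHom.ker_rangeRestrict, ker_innerUnit])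
  have hle : commutator H ≤ ⁅commutator H, commutator H⁆ := by
    conv_lhs => rw [commutator_def]
    rw [Subgroup.commutator_le]
    intro x _ y _
    have hmem := Subgroup.commutator_mem_commutator
      (h.mem_commutator_iff.2 (h.apply_mul_inv x)) (h.mem_commutator_iff.2 (h.apply_mul_inv y))
    have heq : ⁅x * (ε x)⁻¹, y * (ε y)⁻¹⁆ = ⁅x, y⁆ := by
      rw [commutatorElement_def, commutatorElement_def]
      calc x * (ε x)⁻¹ * (y * (ε y)⁻¹) * (x * (ε x)⁻¹)⁻¹ * (y * (ε y)⁻¹)⁻¹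
          = x * (ε x)⁻¹ * y * (ε y)⁻¹ * (ε x * x⁻¹) * (ε y * y⁻¹) := by group
        _ = x * (ε x)⁻¹ * y * (ε y)⁻¹ * x⁻¹ * (ε x * (ε y * y⁻¹)) := by rw [hεc x x⁻¹]; group
        _ = x * (ε x)⁻¹ * (y * (ε y)⁻¹ * x⁻¹ * ε y) * (y⁻¹ * ε x) := by
          rw [hεc x (ε y * y⁻¹)]; group
        _ = x * ((ε x)⁻¹ * y * (ε y)⁻¹ * (ε y * x⁻¹)) * (y⁻¹ * ε x) := by rw [hεc y x⁻¹]; group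
        _ = x * (ε x)⁻¹ * (y * x⁻¹ * y⁻¹ * ε x) := by group
        _ = x * y * x⁻¹ * y⁻¹ := by rw [← hεc x (y * x⁻¹ * y⁻¹)]; group
    rwa [heq] at hmem
  have hsol : Group.IsSolvable H := inferInstance
  have hbot : commutator H = ⊥ := by
    by_contra hne
    exact (Group.IsSolvable.commutator_lt_of_ne_bot hne).not_ge hle
  refine h.eq_one_of_forall_apply fun m hm => ?_
  rwa [← h.mem_commutator_iff, hbot, Subgroup.mem_bot] at hm

theorem isPGroup_commutator (h : IsEndProjection p q v k ε) : IsPGroup p (commutator H) := by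
  have := h.finite
  have := h.finite_range_innerUnit
  obtain ⟨V, hVp, hV, -⟩ := h.profile.translations
  have hinn : ∀ x : H, ∃ a : ℕ, innerUnit H x ^ (q * p ^ a) = 1 := by
    intro x
    have h1 : innerUnit H (ε (x ^ q)) = 1 := by
      obtain ⟨n, hn⟩ := h.exists_pow_eq_apply x
      rw [map_pow, ← hn, ← pow_mul, mul_comm, pow_mul, innerUnit_eq_one_iff]
      exact Subgroup.pow_mem _ h.gen_pow_mem_center n
    have h2 := h.innerUnit_mem hV (h.apply_mul_inv (x ^ q))
    rw [map_mul, map_inv, h1, inv_one, mul_one] at h2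
    obtain ⟨a, ha⟩ := hVp ⟨_, h2⟩
    refine ⟨a, ?_⟩
    rw [pow_mul, ← map_pow]
    exact congrArg Subtype.val ha
  rintro ⟨m, hm⟩
  rw [h.mem_commutator_iff] at hm
  obtain ⟨a, ha⟩ : ∃ a : ℕ, orderOf m = p ^ a := by
    refine ⟨_, Nat.eq_prime_pow_of_unique_prime_dvd (orderOf_pos m).ne' fun {r} hr hrm => ?_⟩
    have hr' := Fact.mk hr
    -- A prime dividing the order of `m` divides the order of the inner automorphism group. By
    -- Cauchy it is `p` or `q`, and `H'` has no `q`-torsion.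
    have h1 : r ∣ Nat.card (innerUnit H).range := by
      rw [← Subgroup.index_ker, ker_innerUnit]
      exact hrm.trans (orderOf_dvd_of_pow_eq_one (h.pow_index_center_eq_one hm))
    obtain ⟨y, hy⟩ := exists_prime_orderOf_dvd_card' r h1
    obtain ⟨x, hxy⟩ := y.2
    have hx : orderOf (innerUnit H x) = r := by rw [hxy, Subgroup.orderOf_coe, hy]
    obtain ⟨a, ha⟩ := hinn x
    have h2 := orderOf_dvd_of_pow_eq_one ha
    rw [hx, hr.dvd_mul] at h2
    rcases h2 with h2 | h2
    · rw [Nat.prime_dvd_prime_iff_eq hr h.prime_q] at h2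
      subst h2
      exfalso
      have h3 : orderOf (m ^ (orderOf m / r)) = r :=
        orderOf_pow_orderOf_div (orderOf_pos m).ne' hrm
      have h4 := h.eq_one_of_pow_prime (m := m ^ (orderOf m / r)) (by rw [map_pow, hm, one_pow])
        (by rw [← orderOf_dvd_iff_pow_eq_one, h3])
      rw [h4, orderOf_one] at h3
      exact hr.one_lt.ne h3
    · exact (Nat.prime_dvd_prime_iff_eq hr h.prime_p).1 (hr.dvd_of_dvd_pow h2)
  exact ⟨a, Subtype.ext (by
    change m ^ p ^ a = 1
    rw [← ha, pow_orderOf_eq_one])⟩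

theorem exists_pow_eq_one (h : IsEndProjection p q v k ε) {m : H} (hm : ε m = 1) :
    ∃ a : ℕ, m ^ p ^ a = 1 := by
  obtain ⟨a, ha⟩ := h.isPGroup_commutator ⟨m, h.mem_commutator_iff.2 hm⟩
  exact ⟨a, congrArg Subtype.val ha⟩

theorem not_isNilpotent (h : IsEndProjection p q v k ε) : ¬ Group.IsNilpotent H := by
  intro hnil
  have := h.finite
  refine h.gen_not_mem_center (h.mem_center_of_commute fun m hm => ?_)
  obtain ⟨a, ha⟩ := h.exists_pow_eq_one hm
  exact (commute_of_pow_eq_one_of_isNilpotent h.prime_p h.prime_q h.p_ne_q ha h.gen_pow).symm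

/-- A subgroup mapping onto the complement contains an element of `q`-power order that is mapped to
the generator of the complement. -/
theorem exists_mem_pow_eq_one (h : IsEndProjection p q v k ε) {L : Subgroup H} {y : H}
    (hy : y ∈ L) (hyk : ε y = k) : ∃ z ∈ L, ε z = k ∧ z ^ q ^ v = 1 := by
  obtain ⟨a, ha⟩ := h.exists_pow_eq_one (m := y ^ q ^ v) (by rw [map_pow, hyk, h.gen_pow])
  have hcop : (q ^ v).Coprime (p ^ a) :=
    ((Nat.coprime_primes h.prime_q h.prime_p).2 h.p_ne_q.symm).pow v a
  -- The exponent `N` extracts the `q`-part of `y`: `N ≡ 1` modulo `q ^ v` and `N ≡ 0` modulo `p ^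
  -- a`.
  obtain ⟨N, hN1, hN0⟩ := Nat.chineseRemainder hcop 1 0
  obtain ⟨b, rfl⟩ := (Nat.modEq_zero_iff_dvd).1 hN0
  refine ⟨y ^ (p ^ a * b), L.pow_mem hy _, ?_, ?_⟩
  · rw [map_pow, hyk]
    conv_rhs => rw [← pow_one k]
    rw [pow_eq_pow_iff_modEq, h.orderOf_eq]
    exact hN1
  · rw [← pow_mul, show p ^ a * b * q ^ v = q ^ v * p ^ a * b by ring, pow_mul, pow_mul, ha,
      one_pow]

/-- Here `ε` maps `L` into the central subgroup `⟨k ^ q⟩`, so `L` acts on `H` through the `p`-group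
`V`, with kernel central in `L`. -/
theorem isNilpotent_of_forall_apply_ne (h : IsEndProjection p q v k ε) {L : Subgroup H}
    (hL : ∀ y ∈ L, ε y ≠ k) : Group.IsNilpotent L := by
  have := h.finite
  have := h.profile.finite
  have := Fact.mk h.prime_p
  obtain ⟨V, hVp, hV, -⟩ := h.profile.translations
  have hLV : ∀ y : L, innerUnit H y ∈ V := by
    rintro ⟨y, hy⟩
    obtain ⟨n, hn⟩ := h.exists_pow_eq_apply y
    have hqn : q ∣ n := by
      by_contra hqn
      have hcop : n.Coprime (q ^ v) :=
        (((Nat.Prime.coprime_iff_not_dvd h.prime_q).2 hqn).symm).pow_right v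
      obtain ⟨j, -, hj⟩ := Nat.exists_mul_mod_eq_one_of_coprime hcop
        (Nat.one_lt_pow (Nat.one_le_iff_ne_zero.1 h.one_le_v) h.prime_q.one_lt)
      refine hL (y ^ j) (L.pow_mem hy j) ?_
      rw [map_pow, ← hn, ← pow_mul]
      conv_rhs => rw [← pow_one k]
      rw [pow_eq_pow_iff_modEq, h.orderOf_eq, Nat.ModEq, hj,
        Nat.mod_eq_of_lt (Nat.one_lt_pow (Nat.one_le_iff_ne_zero.1 h.one_le_v) h.prime_q.one_lt)]
    obtain ⟨j, rfl⟩ := hqn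
    have h1 : innerUnit H (ε y) = 1 := by
      rw [← hn, pow_mul, innerUnit_eq_one_iff]
      exact Subgroup.pow_mem _ h.gen_pow_mem_center j
    have h2 := h.innerUnit_mem hV (h.apply_mul_inv y)
    rwa [map_mul, map_inv, h1, inv_one, mul_one] at h2
  have : Group.IsNilpotent V := hVp.isNilpotent
  refine Subgroup.isNilpotent_of_ker_le_center
    (((innerUnit H).comp L.subtype).codRestrict V hLV) fun y hy => ?_
  have h1 : innerUnit H y = 1 := congrArg Subtype.val hy
  rw [innerUnit_eq_one_iff, Subgroup.mem_center_iff] at h1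
  exact Subgroup.mem_center_iff.2 fun g => Subtype.ext (h1 g)

/-- A `q`-element `z` of `L` over `k` is an automorphic image of `k`, so conjugation by it has order
`q` and is irreducible on `V`. Hence `L ∩ H'` induces either nothing or all of `V`. -/
theorem isNilpotent_of_apply_eq (h : IsEndProjection p q v k ε) {L : Subgroup H} (hL : L ≠ ⊤)
    {y : H} (hy : y ∈ L) (hyk : ε y = k) : Group.IsNilpotent L := by
  have := h.finite
  obtain ⟨V, hVp, hV, hirr⟩ := h.profile.translations
  obtain ⟨z, hzL, hzk, hzq⟩ := h.exists_mem_pow_eq_one hy hyk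
  obtain ⟨α, hα, hαz⟩ := h.exists_unit_apply_inv hzq
  rw [mem_fixer_iff_apply.1 (inv_mem hα), hzk] at hαz
  have hz : (α : Monoid.End H) k = z := by rw [hαz, unit_apply_inv_self]
  have htq : innerUnit H z ^ q = 1 := by
    rw [← map_pow, ← hz, ← map_pow, h.apply_gen_pow hα, innerUnit_eq_one_iff]
    exact h.gen_pow_mem_center
  have ht1 : innerUnit H z ≠ 1 := by
    intro h1
    rw [← hz, ← unit_conj_innerUnit, conj_eq_one_iff, innerUnit_eq_one_iff] at h1
    exact h.gen_not_mem_center h1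
  have hsub : ∀ N : Subgroup H, (∀ m ∈ N, ε m = 1) → (∀ m ∈ N, z * m * z⁻¹ ∈ N) →
      N.map (innerUnit H) = ⊥ ∨ N.map (innerUnit H) = V := by
    intro N hN hzN
    refine hirr _ (h.innerUnit_mem_fixer z) htq ht1 _ ?_ ?_
    · rintro _ ⟨m, hm, rfl⟩
      exact h.innerUnit_mem hV (hN m hm)
    · rintro _ ⟨m, hm, rfl⟩
      exact ⟨_, hzN m hm, by rw [map_mul, map_mul, map_inv]⟩
  have hconj : ∀ m, ε m = 1 → ε (z * m * z⁻¹) = 1 := by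
    intro m hm
    rw [map_mul, map_mul, map_inv, hm, mul_one, mul_inv_cancel]
  rcases hsub (L ⊓ MonoidHom.ker (show H →* H from ε)) (fun m hm => (Subgroup.mem_inf.1 hm).2)
    (fun m hm => Subgroup.mem_inf.2 ⟨L.mul_mem (L.mul_mem hzL (Subgroup.mem_inf.1 hm).1)
      (L.inv_mem hzL), hconj m (Subgroup.mem_inf.1 hm).2⟩) with hbot | htop
  -- Now `L ∩ H'` is central, with quotient embedded in `⟨k⟩`.
  · let : CommGroup (Subgroup.zpowers k) := IsCyclic.commGroup
    have hnil : Group.IsNilpotent (Subgroup.zpowers k) := inferInstance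
    refine Subgroup.isNilpotent_of_ker_le_center
      (((show H →* H from ε).comp L.subtype).codRestrict (Subgroup.zpowers k)
        fun x => h.apply_mem x) fun x hx => ?_
    have h1 : ε (x : H) = 1 := congrArg Subtype.val hx
    have h2 : innerUnit H (x : H) ∈
        (L ⊓ MonoidHom.ker (show H →* H from ε)).map (innerUnit H) :=
      ⟨x, Subgroup.mem_inf.2 ⟨x.2, h1⟩, rfl⟩
    rw [hbot, Subgroup.mem_bot, innerUnit_eq_one_iff, Subgroup.mem_center_iff] at h2
    exact Subgroup.mem_center_iff.2 fun g => Subtype.ext (h2 g)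
  · exfalso
    have hdecomp : ∀ x : H, ∃ n : ℕ, ε (x * (z ^ n)⁻¹) = 1 := by
      intro x
      obtain ⟨n, hn⟩ := h.exists_pow_eq_apply x
      exact ⟨n, by rw [map_mul, map_inv, map_pow, hzk, hn, mul_inv_cancel]⟩
    -- Every inner automorphism now comes from `L`, so all commutators of `H` lie in `L`; together
    -- with `z` they generate `H`.
    have hinn : ∀ x : H, ∃ l ∈ L, innerUnit H x = innerUnit H l := by
      intro x
      obtain ⟨n, hn⟩ := hdecomp x
      have h1 := h.innerUnit_mem hV hn
      rw [← htop] at h1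
      obtain ⟨l, hl, hlx⟩ := h1
      refine ⟨l * z ^ n, L.mul_mem (Subgroup.mem_inf.1 hl).1 (L.pow_mem hzL n), ?_⟩
      rw [map_mul, hlx, ← map_mul, inv_mul_cancel_right]
    have hcomm : commutator H ≤ L := by
      rw [commutator_def, Subgroup.commutator_le]
      intro x _ w _
      obtain ⟨l, hl, hlx⟩ := hinn x
      obtain ⟨l', hl', hlw⟩ := hinn w
      have h1 : x * w * x⁻¹ = l * w * l⁻¹ :=
        DFunLike.congr_fun (congrArg Units.val hlx) w
      have h2 : w * l⁻¹ * w⁻¹ = l' * l⁻¹ * l'⁻¹ :=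
        DFunLike.congr_fun (congrArg Units.val hlw) l⁻¹
      have h3 : ⁅x, w⁆ = l * (l' * l⁻¹ * l'⁻¹) := by
        rw [commutatorElement_def, h1, ← h2]; group
      rw [h3]
      exact L.mul_mem hl (L.mul_mem (L.mul_mem hl' (L.inv_mem hl)) (L.inv_mem hl'))
    refine hL (eq_top_iff.2 fun x _ => ?_)
    obtain ⟨n, hn⟩ := hdecomp x
    have := L.mul_mem (hcomm (h.mem_commutator_iff.2 hn)) (L.pow_mem hzL n)
    rwa [inv_mul_cancel_right] at this

theorem isSchmidtGroupWith (h : IsEndProjection p q v k ε) : IsSchmidtGroupWith p q v H := by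
  refine ⟨⟨h.finite, h.not_isNilpotent, fun L hL => ?_⟩, h.prime_p, h.prime_q, h.p_ne_q,
    h.one_le_v, h.isPGroup_commutator, Subgroup.zpowers k, inferInstance, ?_, ?_⟩
  · by_cases hy : ∃ y ∈ L, ε y = k
    · obtain ⟨y, hy, hyk⟩ := hy
      exact h.isNilpotent_of_apply_eq hL hy hyk
    · exact h.isNilpotent_of_forall_apply_ne fun y hyL hyk => hy ⟨y, hyL, hyk⟩
  · rw [Nat.card_zpowers, h.orderOf_eq]
  · apply Subgroup.isComplement'_of_disjoint_and_mul_eq_univ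
    · rw [Subgroup.disjoint_def]
      rintro _ hx ⟨n, rfl⟩
      have h1 := h.mem_commutator_iff.1 hx
      simp only [map_zpow, h.apply_gen] at h1
      exact h1
    · rw [Set.eq_univ_iff_forall]
      intro x
      exact Set.mem_mul.2 ⟨_, h.mem_commutator_iff.2 (h.apply_mul_inv x), _, h.apply_mem x,
        inv_mul_cancel_right _ _⟩

end IsEndProjection

theorem theorem3p2 (p q v : ℕ) (G : Type*) [Group G] (H : Type*) [Group H]
    (hG : IsSchmidtGroupWith p q v G)
    (e : Nonempty (Monoid.End G ≃* Monoid.End H)) :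
    IsSchmidtGroupWith p q v H := by
  obtain ⟨e⟩ := e
  obtain ⟨c, ε, hε⟩ := hG.exists_projection
  obtain ⟨k, hk⟩ := (hε.endProfile.map e).exists_isEndProjection hG.prime_p hG.prime_q hG.p_ne_q
    hG.one_le_v
  exact hk.isSchmidtGroupWith
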